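/- **Setting.** Let $D$ be even, and let $\Theta$ be the block-diagonal $D\times D$ matrix with blocks $\begin{pmatrix}0&\theta\\-\theta&0\end{pmatrix}$. Let $\theta,m,a$ be real with $0<a\le\frac14\theta^2m^4$, and let $$C(k)=\frac1{k^2+m^2+\frac{a}{\theta^2k^2}}\qquad(C(0)=0\ \text{by continuity}).$$ Let $-m_1^2,-m_2^2$ be the roots $s$ of $\theta^2s(s+m^2)+a$. Let $G$ be a ribbon graph with $n$ vertices, $L$ internal lines $e$ and external legs $x$, given by a cyclic order of the half-edges at each vertex. Let $F$ be the number of its faces. $G$ is *planar regular* if it is connected, $n-L+F=2$, and at most one face (the external one) meets external legs. Let $p_x\in\mathbb R^D$ be incoming external momenta with $\sum_xp_x=0$. **Amplitude.** A vertex with incoming momenta $K_0,K_1,\dots$ in cyclic order contributes $\delta^D(\sum_iK_i)\,e^{-\frac i2\sum_{i<j}K_i\Theta K_j}$, and an internal line $e$ contributes $C(k_e)$. The (amputated) amplitude $\mathcal A_G(p)$ is the integral of the product of these factors over all internal momenta, without the overall $\delta^D(\sum_x p_x)$. Concretely, choose a spanning tree $T$, solve momentum conservation for the momenta of the lines of $T$,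 and integrate over the momenta of the $L-n+1$ other lines. For $\varepsilon\ge0$ let $\mathcal A_G^{\varepsilon}$ be defined in the same way with $e^{-\varepsilon(k^2+m^2)}C(k)$ in place of $C(k)$ (a cutoff $\alpha>\varepsilon$ on the Schwinger parameters), so that $\mathcal A^0_G=\mathcal A_G$. **Symanzik polynomials.** $$U(\alpha)=\sum_{T}\prod_{\ell\notin T}\alpha_\ell,\qquad V(\alpha,p)=\sum_{T_2}\prod_{\ell\notin T_2}\alpha_\ell\Big(\sum_{x\in E(T_2)}p_x\Big)^2,$$ where $T$ runs over the spanning trees, $T_2$ over the 2-trees (spanning trees minus one line), and $E(T_2)$ is one of the two components of $T_2$. **Theorem.** Let $G$ be planar regular and let $T$ be any spanning tree. Let $\varepsilon\ge0$; if $\varepsilon=0$, assume that the corresponding commutative amplitude, with integrand $\prod_e\frac1{k_e^2+m^2}$, converges absolutely. Then the integral $\mathcal A^\varepsilon_G(p)$ and the $2^L$ integrals below converge absolutely, and $$\mathcal A_G^{\varepsilon}(p)=e^{-\frac i2\sum_{i<j}p_{x_i}\Theta p_{x_j}}\;\pi^{\frac{D(L-n+1)}2}\sum_{r=0}^{L}\Big(-\frac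 a{\theta^2}\Big)^r\sum_{\substack{J\subseteq\{1,\dots,L\}\\|J|=r}}I_J^{\varepsilon}(p),$$ $$I_J^{\varepsilon}(p)=\int\prod_{e=1}^Ld\alpha_e\prod_{e\in J}d\alpha_e^{(1)}d\alpha_e^{(2)}\;\frac{e^{-V(\beta,p)/U(\beta)}}{U(\beta)^{D/2}}\;e^{-\sum_{e=1}^L\alpha_em^2}\,e^{-\sum_{e\in J}\alpha_e^{(1)}m_1^2}\,e^{-\sum_{e\in J}\alpha_e^{(2)}m_2^2}$$ over $\alpha_e>\varepsilon$, $\alpha_e^{(1)}>0$, $\alpha_e^{(2)}>0$, with $\beta_e=\alpha_e+\alpha_e^{(1)}+\alpha_e^{(2)}$ for $e\in J$ (the lines that carry the noncommutative correction) and $\beta_e=\alpha_e$ for $e\notin J$. Here $x_0,x_1,\dots$ are the external legs in the order in which they appear along the external face; this prefactor is the trivial Moyal phase that couples the external momenta to themselves. -/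

import Mathlib

noncomputable section

/-- A ribbon graph with vertices `V`, internal lines `E` and external legs `X`.
The half-edges are the two ends `(e, false)` (where the line `e` starts) and `(e, true)` (where it
ends) of every internal line, and the external legs; the orientation of the lines is a bookkeeping
device.  `rot` sends a half-edge to the next one in the cyclic order around its vertex, so the
vertices are exactly the cycles of `rot`.  `base v` is a half-edge at `v`, from which the cyclic
word of the vertex is read. -/
structure RibbonGraph (V E X : Type*) where
  rot : Equiv.Perm ((E × Bool) ⊕ X)
  vert : (E × Bool) ⊕ X → V
  sameCycle_iff : ∀ h h', rot.SameCycle h h' ↔ vert h = vert h'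
  base : V → (E × Bool) ⊕ X
  vert_base : ∀ v, vert (base v) = v

/-- The block-diagonal noncommutativity
matrix `Θ`, with blocks `(0, θ; -θ, 0)`. -/
def moyalMatrix (D : ℕ) (θ : ℝ) : Matrix (Fin D) (Fin D) ℝ :=
  Matrix.of fun i j =>
    if i.val % 2 = 0 ∧ j.val = i.val + 1 then θ
    else if j.val % 2 = 0 ∧ i.val = j.val + 1 then -θ
    else 0

/-- The pairing `∑ μ ν, k_μ Θ_{μν} q_ν`. -/
def moyalPairing {D : ℕ} (θ : ℝ) (k q : EuclideanSpace ℝ (Fin D)) : ℝ :=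
  ∑ i, ∑ j, k i * moyalMatrix D θ i j * q j

/-- The Moyal phase factor `exp (-(i/2) ∑_{i<j} K_i Θ K_j)` of the momenta `K_0, K_1, …` carried by
`h₀, τ h₀, τ² h₀, …`, the cycle of `τ` through `h₀` being read once. -/
def moyalPhase {H : Type*} {D : ℕ} (θ : ℝ) (τ : Equiv.Perm H) (h₀ : H)
    (K : H → EuclideanSpace ℝ (Fin D)) : ℂ :=
  Complex.exp (-(Complex.I / 2) *
    ((∑ j ∈ Finset.range (Function.minimalPeriod τ h₀), ∑ i ∈ Finset.range j,
      moyalPairing θ (K ((τ ^ i) h₀)) (K ((τ ^ j) h₀)) : ℝ) : ℂ))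

/-- The propagator `1 / (k² + m² + a / (θ² k²))`, extended by its limit `0` to `k = 0`. -/
def ncPropagator {D : ℕ} (θ m a : ℝ) (k : EuclideanSpace ℝ (Fin D)) : ℝ :=
  open Classical in
  if k = 0 then 0 else 1 / (‖k‖ ^ 2 + m ^ 2 + a / (θ ^ 2 * ‖k‖ ^ 2))

/-- `m₁²`: minus the larger root of `θ² s (s + m²) + a`, as a polynomial in `s`. -/
def massSq₁ (θ m a : ℝ) : ℝ :=
  (θ ^ 2 * m ^ 2 - Real.sqrt (θ ^ 4 * m ^ 4 - 4 * θ ^ 2 * a)) / (2 * θ ^ 2)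

/-- `m₂²`: minus the smaller root of `θ² s (s + m²) + a`, as a polynomial in `s`. -/
def massSq₂ (θ m a : ℝ) : ℝ :=
  (θ ^ 2 * m ^ 2 + Real.sqrt (θ ^ 4 * m ^ 4 - 4 * θ ^ 2 * a)) / (2 * θ ^ 2)

namespace RibbonGraph

variable {V E X : Type*}

/-- The involution that exchanges the two ends of every internal line and fixes the external legs. -/
def flip (E X : Type*) : Equiv.Perm ((E × Bool) ⊕ X) :=
  Equiv.sumCongr (Equiv.prodCongr (Equiv.refl E) Equiv.boolNot) (Equiv.refl X)

/-- Going along the border of the ribbons: the faces are the cycles of this permutation, and a face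
meets the external legs that its cycle contains. -/
def facePerm (G : RibbonGraph V E X) : Equiv.Perm ((E × Bool) ⊕ X) :=
  flip E X * G.rot

/-- The faces. -/
abbrev Face (G : RibbonGraph V E X) : Type _ :=
  Quotient (Equiv.Perm.SameCycle.setoid G.facePerm)

/-- The faces broken by external legs. -/
def brokenFaces (G : RibbonGraph V E X) : Set G.Face :=
  {f | ∃ x : X, f = Quotient.mk _ (Sum.inr x)}

/-- The (connected) graph has genus `g`: `2 - 2 g = n - L + F`. -/
def HasGenus (G : RibbonGraph V E X) (g : ℕ) : Prop :=
  (2 : ℤ) - 2 * g = (Nat.card V : ℤ) - Nat.card E + Nat.card G.Face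

/-- Planar, and no face other than the external one is broken by external legs. -/
def IsPlanarRegular (G : RibbonGraph V E X) : Prop :=
  G.HasGenus 0 ∧ G.brokenFaces.ncard ≤ 1

/-- The graph on the vertices whose adjacencies come from the lines in `S`. -/
def lineGraph (G : RibbonGraph V E X) (S : Finset E) : SimpleGraph V :=
  SimpleGraph.fromRel fun u v =>
    ∃ e ∈ S, G.vert (Sum.inl (e, false)) = u ∧ G.vert (Sum.inl (e, true)) = v

/-- `T` is (the set of lines of) a spanning tree: it connects all `n` vertices by `n - 1` lines. -/
def IsSpanningTree (G : RibbonGraph V E X) (T : Finset E) : Prop :=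
  (G.lineGraph T).Connected ∧ T.card + 1 = Nat.card V

/-- A 2-tree: a spanning tree minus one of its lines. -/
def IsTwoTree (G : RibbonGraph V E X) [DecidableEq E] (S : Finset E) : Prop :=
  ∃ T, G.IsSpanningTree T ∧ ∃ e ∈ T, S = T.erase e

section Finite

variable [Fintype E] [DecidableEq E] [Fintype X] {D : ℕ}

open Classical in
/-- First Symanzik polynomial: `∑_T ∏_{ℓ ∉ T} α_ℓ` over the spanning trees. -/
def symanzikU (G : RibbonGraph V E X) (α : E → ℝ) : ℝ :=
  ∑ T : Finset E with G.IsSpanningTree T, ∏ e ∈ Tᶜ, α e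

open Classical in
/-- Second Symanzik polynomial: `∑_{T₂} ∏_{ℓ ∉ T₂} α_ℓ (∑_{i ∈ E(T₂)} p_i)²` over the 2-trees, with
`E(T₂)` the component of `T₂` that contains the vertex `v₀`; for `∑ p_i = 0` the other component
gives the same value. -/
def symanzikV (G : RibbonGraph V E X) (v₀ : V) (p : X → EuclideanSpace ℝ (Fin D))
    (α : E → ℝ) : ℝ :=
  ∑ S : Finset E with G.IsTwoTree S, (∏ e ∈ Sᶜ, α e) *
    ‖∑ x : X with (G.lineGraph S).Reachable v₀ (G.vert (Sum.inr x)), p x‖ ^ 2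

/-- The momentum that enters a vertex through a half-edge, for the momenta `k` along the internal
lines and the incoming external momenta `p`. -/
def incoming (p : X → EuclideanSpace ℝ (Fin D)) (k : E → EuclideanSpace ℝ (Fin D)) :
    (E × Bool) ⊕ X → EuclideanSpace ℝ (Fin D)
  | Sum.inl (e, true) => k e
  | Sum.inl (e, false) => -k e
  | Sum.inr x => p x

open Classical in
/-- Momentum conservation at each vertex. -/
def Conserves (G : RibbonGraph V E X) (p : X → EuclideanSpace ℝ (Fin D))
    (k : E → EuclideanSpace ℝ (Fin D)) : Prop :=
  ∀ v : V, ∑ h : (E × Bool) ⊕ X with G.vert h = v, incoming p k h = 0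

/-- The internal momenta, once the vertex `δ` functions have been used to eliminate the momenta of
the lines of the spanning tree `T`: the conserved momenta whose values on the other lines are the
loop momenta `q`. -/
def momenta (G : RibbonGraph V E X) (T : Finset E) (p : X → EuclideanSpace ℝ (Fin D))
    (q : {e // e ∉ T} → EuclideanSpace ℝ (Fin D)) : E → EuclideanSpace ℝ (Fin D) :=
  Classical.epsilon fun k => G.Conserves p k ∧ ∀ e : {e // e ∉ T}, k e = q e

/-- The product over the vertices of the oscillating factors of the Moyal vertices. -/
def vertexPhase [Fintype V] (G : RibbonGraph V E X) (θ : ℝ)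
    (p : X → EuclideanSpace ℝ (Fin D)) (k : E → EuclideanSpace ℝ (Fin D)) : ℂ :=
  ∏ v, moyalPhase θ G.rot (G.base v) (incoming p k)

/-- The phase that couples the external momenta to themselves: the Moyal phase of the external
momenta, in the order in which their legs appear along the face through the half-edge `h₀`. -/
def externalPhase (G : RibbonGraph V E X) (θ : ℝ) (h₀ : (E × Bool) ⊕ X)
    (p : X → EuclideanSpace ℝ (Fin D)) : ℂ :=
  moyalPhase θ G.facePerm h₀ (incoming p 0)

/-- The integrand of the Feynman amplitude, as a function of the loop momenta.  Every propagator
carries the factor `exp (-ε (k² + m²))` of a cutoff `α > ε` on the Schwinger parameters, which is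
absent for `ε = 0`. -/
def feynmanIntegrand [Fintype V] (G : RibbonGraph V E X) (θ m a ε : ℝ) (T : Finset E)
    (p : X → EuclideanSpace ℝ (Fin D)) (q : {e // e ∉ T} → EuclideanSpace ℝ (Fin D)) : ℂ :=
  G.vertexPhase θ p (G.momenta T p q) *
    ((∏ e, Real.exp (-ε * (‖G.momenta T p q e‖ ^ 2 + m ^ 2)) *
      ncPropagator θ m a (G.momenta T p q e) : ℝ) : ℂ)

/-- The (amputated) Feynman amplitude: the coefficient of the overall `δ(∑ p)` in
`∫ ∏ d^D k_e ∏ C(k_e) ∏ (Moyal vertices, with their δ functions)`. -/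
def feynmanAmplitude [Fintype V] (G : RibbonGraph V E X) (θ m a ε : ℝ) (T : Finset E)
    (p : X → EuclideanSpace ℝ (Fin D)) : ℂ :=
  ∫ q : {e // e ∉ T} → EuclideanSpace ℝ (Fin D), G.feynmanIntegrand θ m a ε T p q

/-- Schwinger parameters: `α` for all lines, and `α⁽¹⁾`, `α⁽²⁾` for the lines in `J`. -/
abbrev Schwinger {E : Type*} (J : Finset E) : Type _ :=
  (E → ℝ) × ({e // e ∈ J} → ℝ) × ({e // e ∈ J} → ℝ)

/-- The region `α > ε`, `α⁽¹⁾ > 0`, `α⁽²⁾ > 0`. -/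
def schwingerRegion (ε : ℝ) (J : Finset E) : Set (Schwinger J) :=
  {z | (∀ e, ε < z.1 e) ∧ (∀ e, 0 < z.2.1 e) ∧ ∀ e, 0 < z.2.2 e}

/-- `α_e + α_e⁽¹⁾ + α_e⁽²⁾` on the lines in `J`, and `α_e` on the other lines. -/
def shiftedParam (J : Finset E) (z : Schwinger J) (e : E) : ℝ :=
  if h : e ∈ J then z.1 e + z.2.1 ⟨e, h⟩ + z.2.2 ⟨e, h⟩ else z.1 e

/-- The parametric integrand of the term in which the lines in `J` carry the noncommutative
correction. -/
def paramIntegrand (G : RibbonGraph V E X) (θ m a : ℝ) (v₀ : V)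
    (p : X → EuclideanSpace ℝ (Fin D)) (J : Finset E) (z : Schwinger J) : ℝ :=
  1 / G.symanzikU (shiftedParam J z) ^ ((D : ℝ) / 2) *
    Real.exp (-G.symanzikV v₀ p (shiftedParam J z) / G.symanzikU (shiftedParam J z)) *
    Real.exp (-∑ e, z.1 e * m ^ 2) *
    Real.exp (-∑ e, z.2.1 e * massSq₁ θ m a) *
    Real.exp (-∑ e, z.2.2 e * massSq₂ θ m a)

end Finite

end RibbonGraph

end

/-!
The proof separates the oscillations from the propagators.

*The phase.*  Along the cycle of a vertex, let `P` be a potential whose increments are the incoming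
momenta; then the exponent `∑_{i<j} K_i Θ K_j` of the Moyal phase is `∑ P Θ K`
(`moyalPhase_eq_of_potential`).  In genus zero the potentials of all vertices can be taken from a
single function on the corners which is constant along the faces, except for jumps at the external
legs (`exists_dual_momenta`): by Euler's formula there are as many independent face potentials as
independent loops, so that every circulation is the coboundary of a face potential
(`range_faceCoboundary`).  The two ends of an internal line then give opposite contributions, and
what remains is the Moyal phase of the external legs along the external face
(`vertexPhase_eq_externalPhase`).

*The Gaussian integral.*  The line momenta are affine functions `k₀ + B q` of the loop momenta, with
an integral loop matrix `B`, and the integral of `exp (-∑ β_e k_e²)` is governed by the determinants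
of `Bᵀ β B` and of the same matrix bordered by `k₀`.  The Cauchy–Binet formula expands them in the
maximal minors of `B` and of `(B k₀)`.  The former are `±1` on the complements of spanning trees and
zero otherwise (`det_realLoopMatrix_sq`), the latter are, up to sign, the momentum through the line
removed from a tree on the complements of 2-trees and zero otherwise (`det_borderedMatrix_sq`).
These are the two Symanzik polynomials.

*The propagator.*  By partial fractions the propagator is the commutative one times
`1 - (a / θ²) / ((k² + m₁²) (k² + m₂²))`; expanding the product over the lines gives the sum over
`J`, and the factors are Laplace transforms in the Schwinger parameters.  All integrands being
positive once the phase is pulled out, Tonelli's theorem exchanges the two integrations.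
-/

open MeasureTheory

/-! ### The Cauchy–Binet formula and Gaussian integrals -/

namespace SchwingerGaussian

open Matrix Finset

variable {E ι : Type*} [Fintype E] [DecidableEq E] [Fintype ι] [DecidableEq ι]

theorem det_transpose_mul_diagonal_mul_eq_sum_fun (B : Matrix E ι ℝ) (β : E → ℝ) :
    (Bᵀ * diagonal β * B).det =
      ∑ f : ι → E, (∏ i, β (f i)) * (∏ i, B (f i) i) * (B.submatrix f id).det := by
  have h : (Bᵀ * diagonal β * B) = fun i => ∑ e, (β e * B e i) • B e := by
    ext i j
    simp [Matrix.mul_apply, diagonal_apply, Finset.sum_apply, mul_comm]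
  rw [h]
  change (detRowAlternating.toMultilinearMap) _ = _
  rw [MultilinearMap.map_sum]
  refine Finset.sum_congr rfl fun f _ => ?_
  rw [MultilinearMap.map_smul_univ, Finset.prod_mul_distrib]
  rfl

/-- Averaging the expansion over the orders of the rows turns it into squared minors. -/
theorem factorial_mul_det_transpose_mul_diagonal_mul (B : Matrix E ι ℝ) (β : E → ℝ) :
    (Fintype.card ι).factorial * (Bᵀ * diagonal β * B).det =
      ∑ f : ι → E, (∏ i, β (f i)) * (B.submatrix f id).det ^ 2 := by
  have key : ∀ σ : Equiv.Perm ι, (Bᵀ * diagonal β * B).det =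
      ∑ f : ι → E, (∏ i, β (f i)) *
        ((Equiv.Perm.sign σ : ℤ) * ∏ i, B (f (σ i)) i) * (B.submatrix f id).det := by
    intro σ
    rw [det_transpose_mul_diagonal_mul_eq_sum_fun,
      ← (Equiv.arrowCongr σ.symm (Equiv.refl E)).sum_comp]
    refine Finset.sum_congr rfl fun f _ => ?_
    have h1 : (∏ i, β (f (σ i))) = ∏ i, β (f i) := Equiv.prod_comp σ fun i => β (f i)
    have h2 : (B.submatrix (fun i => f (σ i)) id).det
        = (Equiv.Perm.sign σ : ℤ) * (B.submatrix f id).det := by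
      have := Matrix.det_permute σ (B.submatrix f id)
      simpa [Matrix.submatrix_submatrix, Function.comp_def] using this
    change (∏ i, β (f (σ i))) * (∏ i, B (f (σ i)) i) *
      (B.submatrix (fun i => f (σ i)) id).det = _
    rw [h1, h2]
    ring
  have : ∑ _σ : Equiv.Perm ι, (Bᵀ * diagonal β * B).det
      = (Fintype.card ι).factorial * (Bᵀ * diagonal β * B).det := by
    rw [Finset.sum_const, Finset.card_univ, Fintype.card_perm, nsmul_eq_mul]
  rw [← this, Finset.sum_congr rfl fun σ _ => key σ, Finset.sum_comm]
  refine Finset.sum_congr rfl fun f _ => ?_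
  rw [← Finset.sum_mul, ← Finset.mul_sum, sq, ← mul_assoc]
  congr 2
  rw [det_apply']
  rfl

/-- The number of enumerations of a finite set by `ι`. -/
theorem card_filter_injective_image_eq (S : Finset E) (hS : #S = Fintype.card ι) :
    #{f : ι → E | Function.Injective f ∧ univ.image f = S} = (Fintype.card ι).factorial := by
  have hc : Fintype.card ι = Fintype.card S := by simp [hS]
  let e₀ : ι ≃ S := Fintype.equivOfCardEq hc
  have : ({f : ι → E | Function.Injective f ∧ univ.image f = S} : Finset (ι → E))
      = univ.image fun (σ : Equiv.Perm ι) (i : ι) => (e₀ (σ i) : E) := by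
    ext f
    simp only [mem_filter, mem_univ, true_and, mem_image]
    constructor
    · rintro ⟨hf, him⟩
      have hm : ∀ i, f i ∈ S := fun i => him ▸ mem_image_of_mem f (mem_univ i)
      have hinj : Function.Injective fun i => e₀.symm ⟨f i, hm i⟩ := fun i j hij => by
        have := e₀.symm.injective hij
        exact hf (congrArg Subtype.val this)
      refine ⟨Equiv.ofBijective _ (Finite.injective_iff_bijective.1 hinj), ?_⟩
      ext i
      simp
    · rintro ⟨σ, rfl⟩
      refine ⟨fun i j hij => σ.injective (e₀.injective (Subtype.ext hij)), ?_⟩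
      ext x
      simp only [mem_image, mem_univ, true_and]
      constructor
      · rintro ⟨i, rfl⟩
        exact (e₀ (σ i)).2
      · intro hx
        exact ⟨σ.symm (e₀.symm ⟨x, hx⟩), by simp⟩
  rw [this, card_image_of_injective, card_univ, Fintype.card_perm]
  intro σ τ h
  ext i
  exact e₀.injective (Subtype.ext (congrFun h i))

/-- The Cauchy–Binet formula for `Bᵀ β B` with `β` diagonal.  The squared maximal minor of `B` on a
set `S` of rows does not depend on the order of the rows; it is supplied as `c S`. -/
theorem det_transpose_mul_diagonal_mul (B : Matrix E ι ℝ) (β : E → ℝ) (c : Finset E → ℝ)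
    (hc : ∀ f : ι → E, Function.Injective f → (B.submatrix f id).det ^ 2 = c (univ.image f)) :
    (Bᵀ * diagonal β * B).det =
      ∑ S ∈ powersetCard (Fintype.card ι) univ, (∏ e ∈ S, β e) * c S := by
  have hfac : ((Fintype.card ι).factorial : ℝ) ≠ 0 := by positivity
  refine mul_left_cancel₀ hfac ?_
  rw [factorial_mul_det_transpose_mul_diagonal_mul]
  have h0 : ∑ f : ι → E, (∏ i, β (f i)) * (B.submatrix f id).det ^ 2 =
      ∑ f : ι → E with Function.Injective f, (∏ i, β (f i)) * (B.submatrix f id).det ^ 2 := by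
    symm
    refine Finset.sum_subset (filter_subset _ _) fun f _ hf => ?_
    obtain ⟨i, j, hij, hne⟩ := Function.not_injective_iff.1 fun h => hf (by simpa using h)
    rw [Matrix.det_zero_of_row_eq hne (by ext k; simp [hij])]
    simp
  have hmaps : ∀ f ∈ ({f : ι → E | Function.Injective f} : Finset (ι → E)),
      univ.image f ∈ powersetCard (Fintype.card ι) (univ : Finset E) := by
    intro f hf
    simp only [mem_filter, mem_univ, true_and] at hf
    simp [mem_powersetCard, card_image_of_injective _ hf]
  rw [h0, ← Finset.sum_fiberwise_of_maps_to hmaps, Finset.mul_sum]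
  refine Finset.sum_congr rfl fun S hS => ?_
  rw [mem_powersetCard] at hS
  rw [Finset.sum_congr (g := fun _ => (∏ e ∈ S, β e) * c S) rfl, Finset.sum_const, filter_filter,
    card_filter_injective_image_eq S hS.2, nsmul_eq_mul]
  intro f hf
  simp only [mem_filter, mem_univ, true_and] at hf
  rw [hc f hf.1, ← hf.2, prod_image fun i _ j _ h => hf.1 h]

section Gaussian

variable {D : ℕ}

/-- A square matrix acting on families of vectors, the same way on each coordinate. -/
def vecMap (D : ℕ) (A : Matrix ι ι ℝ) :
    (ι → EuclideanSpace ℝ (Fin D)) →ₗ[ℝ] (ι → EuclideanSpace ℝ (Fin D)) where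
  toFun q i := ∑ j, A i j • q j
  map_add' q q' := by ext; simp [Finset.sum_add_distrib]
  map_smul' r q := by
    ext i : 1
    simp [Finset.smul_sum, smul_comm r]

/-- The coordinates of a family of vectors, as one real vector. -/
def uncurryEquiv (ι : Type*) (D : ℕ) :
    (ι → EuclideanSpace ℝ (Fin D)) ≃ₗ[ℝ] (ι × Fin D → ℝ) where
  toFun q x := q x.1 x.2
  invFun u i := WithLp.toLp 2 fun μ => u (i, μ)
  map_add' _ _ := rfl
  map_smul' _ _ := rfl
  left_inv _ := rfl
  right_inv _ := rfl

open scoped Kronecker in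
theorem det_vecMap (A : Matrix ι ι ℝ) : LinearMap.det (vecMap D A) = A.det ^ D := by
  rw [← LinearMap.det_conj (vecMap D A) (uncurryEquiv ι D)]
  have : ((uncurryEquiv ι D).toLinearMap ∘ₗ vecMap D A ∘ₗ (uncurryEquiv ι D).symm.toLinearMap)
      = Matrix.toLin' (A ⊗ₖ (1 : Matrix (Fin D) (Fin D) ℝ)) := by
    apply LinearMap.ext
    intro u
    ext ⟨i, μ⟩
    change (∑ j, A i j • (uncurryEquiv ι D).symm u j) μ = _
    simp [uncurryEquiv, Matrix.mulVec, dotProduct, Fintype.sum_prod_type, Matrix.one_apply]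
  change LinearMap.det ((uncurryEquiv ι D).toLinearMap ∘ₗ vecMap D A ∘ₗ
    (uncurryEquiv ι D).symm.toLinearMap) = _
  rw [this, LinearMap.det_toLin', det_kronecker]
  simp

omit [DecidableEq ι] in
theorem integral_exp_neg_sum_norm_sq :
    ∫ q : ι → EuclideanSpace ℝ (Fin D), Real.exp (-∑ i, ‖q i‖ ^ 2) =
      Real.pi ^ ((D : ℝ) * Fintype.card ι / 2) := by
  have h : ∀ q : ι → EuclideanSpace ℝ (Fin D), Real.exp (-∑ i, ‖q i‖ ^ 2) =
      ∏ i, Real.exp (-‖q i‖ ^ 2) := fun q => by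
    rw [← Real.exp_sum, Finset.sum_neg_distrib]
  simp_rw [h]
  rw [integral_fintype_prod_volume_eq_pow (fun v : EuclideanSpace ℝ (Fin D) => Real.exp (-‖v‖ ^ 2))]
  have := GaussianFourier.integral_rexp_neg_mul_sq_norm (V := EuclideanSpace ℝ (Fin D)) one_pos
  simp only [neg_mul, one_mul, div_one, finrank_euclideanSpace, Fintype.card_fin] at this
  rw [this, ← Real.rpow_natCast, ← Real.rpow_mul Real.pi_pos.le]
  congr 1
  ring

theorem integral_exp_neg_sum_norm_sq_vecMap (A : Matrix ι ι ℝ) (hA : A.det ≠ 0) :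
    ∫ q : ι → EuclideanSpace ℝ (Fin D), Real.exp (-∑ i, ‖vecMap D A q i‖ ^ 2) =
      (|A.det| ^ D)⁻¹ * Real.pi ^ ((D : ℝ) * Fintype.card ι / 2) := by
  have hdet : LinearMap.det (vecMap D A) ≠ 0 := by
    rw [det_vecMap]; exact pow_ne_zero _ hA
  have hmap := Measure.map_linearMap_addHaar_eq_smul_addHaar
    (volume : Measure (ι → EuclideanSpace ℝ (Fin D))) hdet
  let bas := Module.finBasis ℝ (ι → EuclideanSpace ℝ (Fin D))
  let e : (ι → EuclideanSpace ℝ (Fin D)) ≃L[ℝ] (ι → EuclideanSpace ℝ (Fin D)) :=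
    (LinearEquiv.ofIsUnitDet (f := vecMap D A) (v := bas) (v' := bas)
    (by rw [LinearMap.det_toMatrix]; exact hdet.isUnit)).toContinuousLinearEquiv
  have := integral_map_equiv e.toHomeomorph.toMeasurableEquiv
    (μ := volume) (fun q : ι → EuclideanSpace ℝ (Fin D) => Real.exp (-∑ i, ‖q i‖ ^ 2))
  have hcoe : (⇑e.toHomeomorph.toMeasurableEquiv :
      (ι → EuclideanSpace ℝ (Fin D)) → (ι → EuclideanSpace ℝ (Fin D))) = vecMap D A := rfl
  rw [hcoe, hmap, integral_smul_measure, integral_exp_neg_sum_norm_sq, det_vecMap] at this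
  rw [← this, ENNReal.toReal_ofReal (abs_nonneg _), abs_inv, abs_pow, smul_eq_mul]

/-- Completing the square, the constant term being the Schur complement. -/
theorem sum_mul_sq_eq (B : Matrix E ι ℝ) (β : E → ℝ) (k : E → ℝ) (A : Matrix ι ι ℝ)
    (hA : Aᵀ * A = Bᵀ * diagonal β * B) (hdet : (Bᵀ * diagonal β * B).det ≠ 0) :
    ∃ c : ι → ℝ, ∀ u : ι → ℝ, ∑ e, β e * (k e + ∑ i, B e i * u i) ^ 2 =
      ∑ i, (∑ j, A i j * (u j + c j)) ^ 2 +
        ((fromCols B (replicateCol Unit k))ᵀ * diagonal β *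
          fromCols B (replicateCol Unit k)).det / (Bᵀ * diagonal β * B).det := by
  set M := Bᵀ * diagonal β * B with hM
  have hu : IsUnit M.det := hdet.isUnit
  have : Invertible M := M.invertibleOfIsUnitDet hu
  set b : ι → ℝ := Bᵀ *ᵥ (diagonal β *ᵥ k) with hb
  have hsymm : Mᵀ = M := by
    rw [hM]; simp [Matrix.transpose_mul, Matrix.mul_assoc]
  set c : ι → ℝ := M⁻¹ *ᵥ b with hc
  have hMc : M *ᵥ c = b := by
    rw [hc, mulVec_mulVec, Matrix.mul_nonsing_inv _ hu, one_mulVec]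
  have hblock : (fromCols B (replicateCol Unit k))ᵀ * diagonal β *
      fromCols B (replicateCol Unit k) =
      fromBlocks M (replicateCol Unit b) (replicateRow Unit b)
        (of fun _ _ => k ⬝ᵥ (diagonal β *ᵥ k)) := by
    rw [transpose_fromCols, fromRows_mul, fromRows_mul_fromCols]
    congr 1
    · ext i j
      simp [hb, Matrix.mul_apply, Matrix.mulVec, dotProduct, diagonal_apply, mul_assoc]
    · ext i j
      simp [hb, Matrix.mul_apply, Matrix.mulVec, dotProduct, diagonal_apply]
      exact Finset.sum_congr rfl fun e _ => by ring
    · ext i j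
      simp [Matrix.mul_apply, Matrix.mulVec, dotProduct, diagonal_apply, mul_assoc]
  have hschur : ((fromCols B (replicateCol Unit k))ᵀ * diagonal β *
          fromCols B (replicateCol Unit k)).det / M.det =
      k ⬝ᵥ (diagonal β *ᵥ k) - b ⬝ᵥ c := by
    rw [hblock, det_fromBlocks₁₁, mul_div_cancel_left₀ _ hdet, det_unique]
    simp only [invOf_eq_nonsing_inv, Matrix.sub_apply, of_apply]
    congr 1
    rw [Matrix.mul_assoc]
    simp [Matrix.mul_apply, hc, dotProduct, mulVec]
  refine ⟨c, fun u => ?_⟩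
  rw [hschur]
  have h1 : ∑ e, β e * (k e + ∑ i, B e i * u i) ^ 2 =
      k ⬝ᵥ (diagonal β *ᵥ k) + 2 * (b ⬝ᵥ u) + u ⬝ᵥ (M *ᵥ u) := by
    have e1 : b ⬝ᵥ u = (B *ᵥ u) ⬝ᵥ (diagonal β *ᵥ k) := by
      rw [hb, mulVec_transpose, ← dotProduct_mulVec, dotProduct_comm]
    have e2 : u ⬝ᵥ (M *ᵥ u) = (B *ᵥ u) ⬝ᵥ (diagonal β *ᵥ (B *ᵥ u)) := by
      rw [hM, ← mulVec_mulVec, ← mulVec_mulVec, dotProduct_mulVec, vecMul_transpose]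
    rw [e1, e2]
    simp only [dotProduct, mulVec_diagonal, Finset.mul_sum, ← Finset.sum_add_distrib]
    refine Finset.sum_congr rfl fun e _ => ?_
    simp only [mulVec, dotProduct]
    ring
  have h2 : ∑ i, (∑ j, A i j * (u j + c j)) ^ 2 = (u + c) ⬝ᵥ (M *ᵥ (u + c)) := by
    rw [← hA, ← mulVec_mulVec, dotProduct_mulVec, vecMul_transpose]
    simp [dotProduct, mulVec, sq]
  have h3 : c ⬝ᵥ (M *ᵥ u) = b ⬝ᵥ u := by
    rw [dotProduct_mulVec, ← mulVec_transpose, hsymm, hMc]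
  rw [h1, h2, mulVec_add, dotProduct_add, add_dotProduct, add_dotProduct, h3, hMc,
    dotProduct_comm u b, dotProduct_comm c b]
  ring

open scoped MatrixOrder in
theorem exists_transpose_mul_self_eq {M : Matrix ι ι ℝ} (hM : M.PosSemidef) :
    ∃ A : Matrix ι ι ℝ, Aᵀ * A = M := by
  obtain ⟨A, hA⟩ := CStarAlgebra.nonneg_iff_eq_star_mul_self.mp hM.nonneg
  exact ⟨A, by rw [hA, star_eq_conjTranspose, conjTranspose_eq_transpose_of_trivial]⟩

/-- The Gaussian integral over the loop momenta: the bordered determinants, one for each space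
coordinate, give the minimum of the quadratic form. -/
theorem integral_exp_neg_sum_mul_norm_sq (B : Matrix E ι ℝ) (hB : Function.Injective B.mulVec)
    (β : E → ℝ) (hβ : ∀ e, 0 < β e) (k : E → EuclideanSpace ℝ (Fin D)) :
    ∫ q : ι → EuclideanSpace ℝ (Fin D), Real.exp (-∑ e, β e * ‖k e + ∑ i, B e i • q i‖ ^ 2) =
      Real.pi ^ ((D : ℝ) * Fintype.card ι / 2) *
        (1 / (Bᵀ * diagonal β * B).det ^ ((D : ℝ) / 2) *
        Real.exp (-(∑ μ, ((fromCols B (replicateCol Unit fun e => k e μ))ᵀ * diagonal β *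
          fromCols B (replicateCol Unit fun e => k e μ)).det) / (Bᵀ * diagonal β * B).det)) := by
  have hpos : (Bᵀ * diagonal β * B).PosDef := by
    have := (PosDef.diagonal hβ).conjTranspose_mul_mul_same hB
    simpa [conjTranspose_eq_transpose_of_trivial] using this
  have hdet := hpos.det_pos
  obtain ⟨A, hA⟩ := exists_transpose_mul_self_eq hpos.posSemidef
  have hAdet : A.det ^ 2 = (Bᵀ * diagonal β * B).det := by
    rw [← hA, det_mul, det_transpose, sq]
  -- `A` is a square root of the quadratic form
  have hA0 : A.det ≠ 0 := fun h => by
    rw [h] at hAdet; norm_num at hAdet; exact hdet.ne hAdet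
  choose c hc using fun μ => sum_mul_sq_eq B β (fun e => k e μ) A hA hdet.ne'
  let c' : ι → EuclideanSpace ℝ (Fin D) := fun i => WithLp.toLp 2 fun μ => c μ i
  have hq : ∀ q : ι → EuclideanSpace ℝ (Fin D), ∑ e, β e * ‖k e + ∑ i, B e i • q i‖ ^ 2 =
      ∑ i, ‖vecMap D A (q + c') i‖ ^ 2 +
      (∑ μ, ((fromCols B (replicateCol Unit fun e => k e μ))ᵀ * diagonal β *
          fromCols B (replicateCol Unit fun e => k e μ)).det) / (Bᵀ * diagonal β * B).det := by
    intro q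
    rw [Finset.sum_div]
    simp only [EuclideanSpace.real_norm_sq_eq, Finset.mul_sum]
    rw [Finset.sum_comm, Finset.sum_comm (s := (univ : Finset ι)), ← Finset.sum_add_distrib]
    refine Finset.sum_congr rfl fun μ _ => ?_
    have := hc μ fun i => q i μ
    simpa [vecMap, c', Finset.sum_apply, mul_add] using this
  simp_rw [hq, neg_add, Real.exp_add, ← neg_div]
  rw [integral_mul_const, integral_add_right_eq_self (fun q : ι → EuclideanSpace ℝ (Fin D) =>
    Real.exp (-∑ i, ‖vecMap D A q i‖ ^ 2)), integral_exp_neg_sum_norm_sq_vecMap A hA0]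
  have hr : (Bᵀ * diagonal β * B).det ^ ((D : ℝ) / 2) = |A.det| ^ D := by
    rw [← hAdet, ← sq_abs, ← Real.rpow_natCast, ← Real.rpow_mul (abs_nonneg _),
      ← Real.rpow_natCast]
    congr 1
    push_cast
    ring
  rw [hr]
  ring

end Gaussian

end SchwingerGaussian

/-! ### Flows and spanning trees -/

namespace RibbonGraph

open Finset Matrix

variable {V E X : Type*} [Fintype E]

/-- The vertex where the line `e` starts. -/
def src (G : RibbonGraph V E X) (e : E) : V := G.vert (Sum.inl (e, false))

/-- The vertex where the line `e` ends. -/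
def tgt (G : RibbonGraph V E X) (e : E) : V := G.vert (Sum.inl (e, true))

open Classical in
/-- The net momentum that the lines carry into the vertex `v`. -/
noncomputable def div (G : RibbonGraph V E X) {M : Type*} [AddCommGroup M] (k : E → M)
    (v : V) : M :=
  ∑ e, ((if G.tgt e = v then k e else 0) - if G.src e = v then k e else 0)

variable (G : RibbonGraph V E X) {M : Type*} [AddCommGroup M]

theorem div_add (k k' : E → M) (v : V) :
    G.div (fun e => k e + k' e) v = G.div k v + G.div k' v := by
  classical
  simp only [div, ← Finset.sum_add_distrib]
  refine Finset.sum_congr rfl fun e _ => ?_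
  split_ifs <;> abel

theorem div_sum_zsmul {ι : Type*} (s : Finset ι) (n : ι → E → ℤ) (c : ι → M) (v : V) :
    G.div (fun e => ∑ i ∈ s, n i e • c i) v = ∑ i ∈ s, G.div (n i) v • c i := by
  classical
  simp only [div, Finset.sum_smul, Finset.sum_comm (s := s)]
  refine Finset.sum_congr rfl fun e _ => ?_
  split_ifs <;> simp [Finset.sum_neg_distrib]

theorem div_map {M' : Type*} [AddCommGroup M'] (φ : M →+ M') (k : E → M) (v : V) :
    G.div (fun e => φ (k e)) v = φ (G.div k v) := by
  classical
  simp only [div, map_sum, map_sub]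
  refine Finset.sum_congr rfl fun e _ => ?_
  split_ifs <;> simp

/-- Summation by parts. -/
theorem sum_zsmul_div [Fintype V] (w : V → ℤ) (k : E → M) :
    ∑ v, w v • G.div k v = ∑ e, (w (G.tgt e) - w (G.src e)) • k e := by
  classical
  simp only [div, Finset.smul_sum]
  rw [Finset.sum_comm]
  refine Finset.sum_congr rfl fun e _ => ?_
  simp [smul_sub, Finset.sum_sub_distrib, sub_smul]

theorem sum_div [Fintype V] (k : E → M) : ∑ v, G.div k v = 0 := by
  simpa using G.sum_zsmul_div (fun _ => 1) k

section Connectivity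

variable {G} [DecidableEq E]

omit [Fintype E] [DecidableEq E] in
theorem reachable_tgt_iff {S : Finset E} {e : E} (he : e ∈ S) (v₀ : V) :
    (G.lineGraph S).Reachable v₀ (G.tgt e) ↔ (G.lineGraph S).Reachable v₀ (G.src e) := by
  have h : (G.lineGraph S).Reachable (G.src e) (G.tgt e) := by
    by_cases hne : G.src e = G.tgt e
    · rw [hne]
    · refine SimpleGraph.Adj.reachable ?_
      rw [lineGraph, SimpleGraph.fromRel_adj]
      exact ⟨hne, Or.inl ⟨e, he, rfl, rfl⟩⟩
  exact ⟨fun h' => h'.trans h.symm, fun h' => h'.trans h⟩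

omit [Fintype E] [DecidableEq E] in
/-- A predicate that no line of a connected `S` separates is constant. -/
theorem forall_of_lineGraph_connected {S : Finset E} (hS : (G.lineGraph S).Connected)
    {P : V → Prop} (hP : ∀ e ∈ S, P (G.src e) ↔ P (G.tgt e)) {v₀ : V} (h₀ : P v₀) (v : V) :
    P v := by
  obtain ⟨w⟩ := hS.preconnected v₀ v
  induction w with
  | nil => exact h₀
  | cons hadj _ ih =>
    refine ih ?_
    rw [lineGraph, SimpleGraph.fromRel_adj] at hadj
    rcases hadj with ⟨-, ⟨e, he, rfl, rfl⟩ | ⟨e, he, rfl, rfl⟩⟩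
    · exact (hP e he).1 h₀
    · exact (hP e he).2 h₀

omit [Fintype E] [DecidableEq E] in
theorem lineGraph_connected_of_forall {S : Finset E} (v₀ : V)
    (h : ∀ v, (G.lineGraph S).Reachable v₀ v) : (G.lineGraph S).Connected :=
  have : Nonempty V := ⟨v₀⟩
  ⟨fun u v => (h u).symm.trans (h v)⟩

/-- `n v` is an integral flow along the lines of `S` that brings one unit from `v₀` to `v`. -/
def IsFlow (G : RibbonGraph V E X) (S : Finset E) (v₀ : V) (n : V → E → ℤ) : Prop :=
  open Classical in
  ∀ v, (∀ e ∉ S, n v e = 0) ∧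
    ∀ u, G.div (n v) u = (if u = v then 1 else 0) - if u = v₀ then 1 else 0

theorem exists_isFlow {S : Finset E} (hS : (G.lineGraph S).Connected) (v₀ : V) :
    ∃ n : V → E → ℤ, G.IsFlow S v₀ n := by
  classical
  suffices h : ∀ v, ∃ n : E → ℤ, (∀ e ∉ S, n e = 0) ∧
      ∀ u, G.div n u = (if u = v then 1 else 0) - if u = v₀ then 1 else 0 by
    choose n hn using h
    exact ⟨n, fun v => by convert hn v⟩
  have hsingle : ∀ (c : ℤ) (e : E) (u : V), G.div (fun e' => if e' = e then c else 0) u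
      = (if G.tgt e = u then c else 0) - if G.src e = u then c else 0 := by
    intro c e u
    rw [div, Finset.sum_eq_single e]
    · simp
    · intro e' _ hne; simp [hne]
    · simp
  refine forall_of_lineGraph_connected hS (v₀ := v₀) (fun e he => ?_) ⟨0, by simp, by simp [div]⟩
  constructor
  · rintro ⟨n, hn, hd⟩
    refine ⟨fun e' => n e' + if e' = e then 1 else 0, fun e' he' => ?_, fun u => ?_⟩
    · have hne : e' ≠ e := fun h => he' (h ▸ he)
      simp [hn e' he', hne]
    · rw [div_add, hd, hsingle]
      simp only [eq_comm (a := u)]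
      ring
  · rintro ⟨n, hn, hd⟩
    refine ⟨fun e' => n e' + if e' = e then -1 else 0, fun e' he' => ?_, fun u => ?_⟩
    · have hne : e' ≠ e := fun h => he' (h ▸ he)
      simp [hn e' he', hne]
    · rw [div_add, hd, hsingle]
      simp only [eq_comm (a := u)]
      split_ifs <;> ring

variable [Fintype V]

/-- The divergence of the real flows supported on `S`, at the vertices other than `v₀`. -/
noncomputable def reducedDiv (G : RibbonGraph V E X) (S : Finset E) (v₀ : V) :
    (S → ℝ) →ₗ[ℝ] ({v // v ≠ v₀} → ℝ) where
  toFun x v := G.div (fun e => if h : e ∈ S then x ⟨e, h⟩ else 0) v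
  map_add' x y := by
    ext v
    rw [Pi.add_apply, ← div_add]
    congr 1
    ext e
    split_ifs <;> simp
  map_smul' c x := by
    ext v
    have := G.div_map (AddMonoidHom.mulLeft c) (fun e => if h : e ∈ S then x ⟨e, h⟩ else 0) v
    simp only [AddMonoidHom.coe_mulLeft] at this
    rw [RingHom.id_apply, Pi.smul_apply, smul_eq_mul, ← this]
    congr 1
    ext e
    split_ifs <;> simp

omit [Fintype V] in
theorem reducedDiv_restrict {S : Finset E} {k : E → ℝ} (hk : ∀ e ∉ S, k e = 0) (v₀ : V)
    (v : {v // v ≠ v₀}) : G.reducedDiv S v₀ (fun e => k e) v = G.div k v := by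
  change G.div (fun e => if h : e ∈ S then k e else 0) v = _
  congr 1
  ext e
  split_ifs with h
  · rfl
  · exact (hk e h).symm

/-- The kernel consists of circulations: momentum is conserved at `v₀` if it is everywhere else. -/
theorem div_eq_zero_of_reducedDiv_eq_zero {S : Finset E} {v₀ : V} {x : S → ℝ}
    (hx : G.reducedDiv S v₀ x = 0) (v : V) :
    G.div (fun e => if h : e ∈ S then x ⟨e, h⟩ else 0) v = 0 := by
  classical
  have h : ∀ v, v ≠ v₀ → G.div (fun e => if h : e ∈ S then x ⟨e, h⟩ else 0) v = 0 :=
    fun v hv => congrFun hx ⟨v, hv⟩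
  by_cases hv : v = v₀
  · have := G.sum_div (fun e => if h : e ∈ S then x ⟨e, h⟩ else 0)
    rw [Finset.sum_eq_single v₀ (fun v _ hv => h v hv) (by simp)] at this
    rw [hv, this]
  · exact h v hv

theorem reducedDiv_surjective {S : Finset E} (hS : (G.lineGraph S).Connected) (v₀ : V) :
    Function.Surjective (G.reducedDiv S v₀) := by
  classical
  intro d
  obtain ⟨n, hn⟩ := exists_isFlow hS v₀
  refine ⟨fun e => ∑ v : {v // v ≠ v₀}, n v e • d v, ?_⟩
  ext u
  rw [reducedDiv_restrict (k := fun e => ∑ v : {v // v ≠ v₀}, n v e • d v), div_sum_zsmul]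
  · rw [Finset.sum_eq_single u]
    · simp [(hn u).2, u.2]
    · intro v _ hv
      have : (u : V) ≠ v := fun h => hv (Subtype.ext h.symm)
      simp [(hn v).2, u.2, this]
    · simp
  · intro e he
    simp [(hn _).1 e he]

theorem connected_of_reducedDiv_surjective {S : Finset E} {v₀ : V}
    (h : Function.Surjective (G.reducedDiv S v₀)) : (G.lineGraph S).Connected := by
  classical
  refine lineGraph_connected_of_forall v₀ ?_
  by_contra! hne
  obtain ⟨v, hv⟩ := hne
  obtain ⟨x, hx⟩ := h fun u => if (u : V) = v then 1 else 0
  have hvv : v ≠ v₀ := fun h => hv (h ▸ SimpleGraph.Reachable.refl _)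
  set k : E → ℝ := fun e => if h : e ∈ S then x ⟨e, h⟩ else 0 with hk
  have hd : ∀ u, u ≠ v₀ → G.div k u = if u = v then 1 else 0 := fun u hu => congrFun hx ⟨u, hu⟩
  have key := G.sum_zsmul_div (fun u => if (G.lineGraph S).Reachable v₀ u then 0 else 1) k
  rw [Finset.sum_eq_zero (s := (univ : Finset E)), Finset.sum_eq_single v] at key
  · simp [hd v hvv, hv] at key
  · intro u _ hu
    by_cases hu0 : u = v₀
    · subst hu0; simp
    · simp [hd u hu0, hu]
  · simp
  · intro e _
    by_cases he : e ∈ S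
    · simp [reachable_tgt_iff he]
    · simp [hk, he]

theorem card_ne (v₀ : V) [Fintype {v // v ≠ v₀}] :
    Fintype.card {v // v ≠ v₀} + 1 = Nat.card V := by
  classical
  have : 0 < Fintype.card V := Fintype.card_pos_iff.2 ⟨v₀⟩
  rw [Nat.card_eq_fintype_card, Fintype.card_subtype_compl, Fintype.card_subtype_eq]
  omega

theorem card_le_of_connected {S : Finset E} (hS : (G.lineGraph S).Connected) :
    Nat.card V ≤ #S + 1 := by
  classical
  obtain ⟨v₀⟩ := hS.nonempty
  have := LinearMap.finrank_le_finrank_of_surjective (reducedDiv_surjective hS v₀)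
  rw [Module.finrank_fintype_fun_eq_card, Module.finrank_fintype_fun_eq_card,
    Fintype.card_coe] at this
  have := card_ne v₀
  omega

/-- Every real circulation supported on `S` vanishes. -/
def IsAcyclic (G : RibbonGraph V E X) (S : Finset E) : Prop :=
  ∀ k : E → ℝ, (∀ e ∉ S, k e = 0) → (∀ v, G.div k v = 0) → k = 0

theorem IsSpanningTree.isAcyclic {T : Finset E} (hT : G.IsSpanningTree T) : G.IsAcyclic T := by
  classical
  intro k hk hd
  obtain ⟨v₀⟩ := hT.1.nonempty
  have hinj : Function.Injective (G.reducedDiv T v₀) := by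
    refine (LinearMap.injective_iff_surjective_of_finrank_eq_finrank ?_).2
      (reducedDiv_surjective hT.1 v₀)
    rw [Module.finrank_fintype_fun_eq_card, Module.finrank_fintype_fun_eq_card, Fintype.card_coe]
    have := card_ne v₀
    have := hT.2
    omega
  have h0 : (fun e : T => k e) = 0 := by
    refine hinj ?_
    ext v
    rw [reducedDiv_restrict hk, hd, map_zero]
    rfl
  ext e
  by_cases he : e ∈ T
  · exact congrFun h0 ⟨e, he⟩
  · exact hk e he

/-- Counting dimensions, an acyclic set with `n - 1` lines has a surjective reduced divergence and
so connects all vertices. -/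
theorem IsAcyclic.isSpanningTree [Nonempty V] {S : Finset E} (hS : G.IsAcyclic S)
    (hc : #S + 1 = Nat.card V) : G.IsSpanningTree S := by
  classical
  obtain ⟨v₀⟩ := ‹Nonempty V›
  refine ⟨connected_of_reducedDiv_surjective (v₀ := v₀) ?_, hc⟩
  refine (LinearMap.injective_iff_surjective_of_finrank_eq_finrank ?_).1 ?_
  · rw [Module.finrank_fintype_fun_eq_card, Module.finrank_fintype_fun_eq_card, Fintype.card_coe]
    have := card_ne v₀
    omega
  · refine (injective_iff_map_eq_zero _).2 fun x hx => ?_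
    have := hS (fun e => if h : e ∈ S then x ⟨e, h⟩ else 0) (fun e he => by simp [he])
      (div_eq_zero_of_reducedDiv_eq_zero hx)
    ext e
    simpa using congrFun this e

end Connectivity

section LoopMatrix

variable {G} [DecidableEq E] [Fintype V]

/-- The matrix of the elementary loops: for a flow `n` along the lines of a spanning tree, the
column of `f` closes the line `f` through the tree. -/
def loopMatrix (G : RibbonGraph V E X) (n : V → E → ℤ) (e f : E) : ℤ :=
  (if e = f then 1 else 0) - (n (G.tgt f) e - n (G.src f) e)

omit [Fintype V] in
theorem loopMatrix_off {S : Finset E} {v₀ : V} {n : V → E → ℤ} (hn : G.IsFlow S v₀ n) {e : E}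
    (he : e ∉ S) (f : E) : G.loopMatrix n e f = if e = f then 1 else 0 := by
  simp [loopMatrix, (hn _).1 e he]

omit [Fintype V] in
theorem div_loopMatrix {S : Finset E} {v₀ : V} {n : V → E → ℤ} (hn : G.IsFlow S v₀ n) (f : E)
    (v : V) : G.div (fun e => G.loopMatrix n e f) v = 0 := by
  classical
  have h1 : (fun e => G.loopMatrix n e f) = fun e => ((if e = f then 1 else 0) +
      -n (G.tgt f) e) + n (G.src f) e := by
    ext e; rw [loopMatrix]; ring
  have h2 := G.div_map (-AddMonoidHom.id ℤ) (n (G.tgt f)) v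
  simp only [AddMonoidHom.neg_apply, AddMonoidHom.id_apply] at h2
  rw [h1, div_add, div_add, h2, (hn _).2, (hn _).2, div, Finset.sum_eq_single f]
  · simp only [eq_comm (a := v), if_true]
    ring
  · intro e _ hne; simp [hne]
  · simp

theorem loopMatrix_tree {T : Finset E} (hT : G.IsSpanningTree T) {v₀ : V} {n : V → E → ℤ}
    (hn : G.IsFlow T v₀ n) {f : E} (hf : f ∈ T) (e : E) : G.loopMatrix n e f = 0 := by
  have h1 : ∀ e ∉ T, Int.castAddHom ℝ (G.loopMatrix n e f) = 0 := by
    intro e he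
    have hne : e ≠ f := fun h => he (h ▸ hf)
    rw [loopMatrix_off hn he, if_neg hne, map_zero]
  have h2 : ∀ v, G.div (fun e => Int.castAddHom ℝ (G.loopMatrix n e f)) v = 0 := by
    intro v
    rw [G.div_map, div_loopMatrix hn, map_zero]
  simpa using congrFun (hT.isAcyclic _ h1 h2) e

/-- Any momenta are determined by their values off the tree and by their divergence. -/
theorem eq_sum_loopMatrix_add {T : Finset E} (hT : G.IsSpanningTree T) {v₀ : V} {n : V → E → ℤ}
    (hn : G.IsFlow T v₀ n) (k : E → M) (e : E) :
    k e = (∑ f : {f // f ∉ T}, G.loopMatrix n e f • k f) + ∑ v, n v e • G.div k v := by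
  classical
  have h1 : (∑ f : {f // f ∉ T}, G.loopMatrix n e f • k f) = ∑ f, G.loopMatrix n e f • k f := by
    rw [← Fintype.sum_subtype_add_sum_subtype (· ∉ T), left_eq_add]
    refine Finset.sum_eq_zero fun f _ => ?_
    rw [loopMatrix_tree hT hn (not_not.1 f.2), zero_smul]
  rw [h1, G.sum_zsmul_div (fun v => n v e), ← Finset.sum_add_distrib]
  simp only [← add_smul, loopMatrix, sub_add_cancel]
  simp

end LoopMatrix

end RibbonGraph

/-! ### Loop matrix and Symanzik polynomials -/

namespace RibbonGraph

open Finset Matrix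

variable {V E X : Type*} [Fintype E] [DecidableEq E] [Fintype V] [Fintype X]
  {G : RibbonGraph V E X} {M : Type*} [AddCommGroup M]

open Classical in
/-- The total external momentum that enters the vertex `v`. -/
noncomputable def external (G : RibbonGraph V E X) (p : X → M) (v : V) : M :=
  ∑ x : X with G.vert (Sum.inr x) = v, p x

/-- The momenta of the lines of a tree, along which the flow `n` runs, for vanishing loop momenta:
all of the external momentum is drained towards the root of the flow. -/
def treeMomenta (G : RibbonGraph V E X) (n : V → E → ℤ) (p : X → M) (e : E) : M :=
  -∑ x, n (G.vert (Sum.inr x)) e • p x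

omit [Fintype E] [DecidableEq E] in
theorem sum_zsmul_external (w : V → ℤ) (p : X → M) :
    ∑ v, w v • G.external p v = ∑ x, w (G.vert (Sum.inr x)) • p x := by
  classical
  simp only [external, Finset.smul_sum]
  rw [← Finset.sum_fiberwise (s := (univ : Finset X)) (fun x => G.vert (Sum.inr x))]
  refine Finset.sum_congr rfl fun v _ => Finset.sum_congr rfl fun x hx => ?_
  rw [(Finset.mem_filter.1 hx).2]

theorem eq_sum_loopMatrix_add_treeMomenta {T : Finset E} (hT : G.IsSpanningTree T) {v₀ : V}
    {n : V → E → ℤ} (hn : G.IsFlow T v₀ n) {p : X → M} {k : E → M}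
    (hk : ∀ v, G.div k v = -G.external p v) (e : E) :
    k e = (∑ f : {f // f ∉ T}, G.loopMatrix n e f • k f) + G.treeMomenta n p e := by
  refine (eq_sum_loopMatrix_add hT hn k e).trans ?_
  simp only [hk, smul_neg, Finset.sum_neg_distrib, treeMomenta,
    sum_zsmul_external (fun v => n v e)]

omit [Fintype V] in
theorem div_sum_loopMatrix_add_treeMomenta {T : Finset E} {v₀ : V}
    {n : V → E → ℤ} (hn : G.IsFlow T v₀ n) {p : X → M} (hp : ∑ x, p x = 0)
    (q : {f // f ∉ T} → M) (v : V) :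
    G.div (fun e => (∑ f : {f // f ∉ T}, G.loopMatrix n e f • q f) + G.treeMomenta n p e) v =
      -G.external p v := by
  classical
  rw [div_add, div_sum_zsmul (n := fun (f : {f // f ∉ T}) e => G.loopMatrix n e f)]
  have h := G.div_map (-AddMonoidHom.id M) (fun e => ∑ x, n (G.vert (Sum.inr x)) e • p x) v
  simp only [AddMonoidHom.neg_apply, AddMonoidHom.id_apply] at h
  change _ + G.div (fun e => -∑ x, n (G.vert (Sum.inr x)) e • p x) v = _
  rw [h, div_sum_zsmul (n := fun x e => n (G.vert (Sum.inr x)) e)]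
  simp only [div_loopMatrix hn, zero_smul, Finset.sum_const_zero, zero_add, (hn _).2, sub_smul,
    Finset.sum_sub_distrib]
  rw [← Finset.smul_sum, hp, smul_zero, sub_zero, external, Finset.sum_filter]
  congr 1
  refine Finset.sum_congr rfl fun x _ => ?_
  simp [eq_comm (a := v)]

omit [DecidableEq E] [Fintype V] in
theorem treeMomenta_off {T : Finset E} {v₀ : V} {n : V → E → ℤ} (hn : G.IsFlow T v₀ n)
    (p : X → M) {e : E} (he : e ∉ T) : G.treeMomenta n p e = 0 := by
  simp [treeMomenta, (hn _).1 e he]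

omit [Fintype V] [DecidableEq E] in
theorem conserves_iff {D : ℕ} {p : X → EuclideanSpace ℝ (Fin D)}
    {k : E → EuclideanSpace ℝ (Fin D)} :
    G.Conserves p k ↔ ∀ v, G.div k v = -G.external p v := by
  classical
  refine forall_congr' fun v => ?_
  rw [Finset.sum_filter, Fintype.sum_sum_type, Fintype.sum_prod_type, eq_neg_iff_add_eq_zero,
    external, Finset.sum_filter, div]
  simp only [Fintype.sum_bool, incoming, tgt, src]
  have h : ∀ e : E, ((if G.vert (Sum.inl (e, true)) = v then k e else 0) +
      if G.vert (Sum.inl (e, false)) = v then -k e else 0) =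
      (if G.vert (Sum.inl (e, true)) = v then k e else 0) -
      if G.vert (Sum.inl (e, false)) = v then k e else 0 := fun e => by
    split_ifs <;> simp [sub_eq_add_neg]
  simp only [h]
  congr!

omit [Fintype V] in
/-- The defining property of the momenta, which the choice in their definition does satisfy. -/
theorem momenta_spec {D : ℕ} {T : Finset E} (hT : G.IsSpanningTree T)
    {p : X → EuclideanSpace ℝ (Fin D)} (hp : ∑ x, p x = 0)
    (q : {e // e ∉ T} → EuclideanSpace ℝ (Fin D)) :
    G.Conserves p (G.momenta T p q) ∧ ∀ e : {e // e ∉ T}, G.momenta T p q e = q e := by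
  obtain ⟨v₀⟩ := hT.1.nonempty
  obtain ⟨n, hn⟩ := exists_isFlow hT.1 v₀
  refine Classical.epsilon_spec (p := fun k => G.Conserves p k ∧ ∀ e : {e // e ∉ T}, k e = q e)
    ⟨_, conserves_iff.2 (div_sum_loopMatrix_add_treeMomenta hn hp q), fun e => ?_⟩
  rw [treeMomenta_off hn p e.2, add_zero, Finset.sum_eq_single e]
  · simp [loopMatrix_off hn e.2]
  · intro f _ hf
    have : (e : E) ≠ f := fun h => hf (Subtype.ext h.symm)
    simp [loopMatrix_off hn e.2, this]
  · simp

/-- The columns of the elementary loops, over the reals. -/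
def realLoopMatrix (G : RibbonGraph V E X) (n : V → E → ℤ) (T : Finset E) :
    Matrix E {f // f ∉ T} ℝ :=
  of fun e f => (G.loopMatrix n e f : ℝ)

theorem momenta_eq {D : ℕ} {T : Finset E} (hT : G.IsSpanningTree T) {v₀ : V}
    {n : V → E → ℤ} (hn : G.IsFlow T v₀ n)
    {p : X → EuclideanSpace ℝ (Fin D)} (hp : ∑ x, p x = 0)
    (q : {e // e ∉ T} → EuclideanSpace ℝ (Fin D)) (e : E) :
    G.momenta T p q e = G.treeMomenta n p e + ∑ f, G.realLoopMatrix n T e f • q f := by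
  obtain ⟨h1, h2⟩ := momenta_spec hT hp q
  rw [eq_sum_loopMatrix_add_treeMomenta hT hn (conserves_iff.1 h1) e, add_comm]
  simp only [h2, realLoopMatrix, of_apply, Int.cast_smul_eq_zsmul]

omit [Fintype V] [Fintype X] in
theorem card_compl_tree {T : Finset E} (hT : G.IsSpanningTree T) :
    Fintype.card {e // e ∉ T} + Nat.card V = Fintype.card E + 1 := by
  have h1 := hT.2
  have h2 : Fintype.card {e // e ∉ T} = Fintype.card E - #T := by
    rw [Fintype.card_subtype_compl, Fintype.card_coe]
  have h3 := Finset.card_le_univ T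
  omega

omit [Fintype X] in
theorem realLoopMatrix_mulVec_restrict {T : Finset E} (hT : G.IsSpanningTree T) {v₀ : V}
    {n : V → E → ℤ} (hn : G.IsFlow T v₀ n) {k : E → ℝ} (hk : ∀ v, G.div k v = 0) (e : E) :
    (G.realLoopMatrix n T *ᵥ fun f => k f) e = k e := by
  rw [eq_sum_loopMatrix_add hT hn k e]
  simp [hk, mulVec, dotProduct, realLoopMatrix]

omit [Fintype V] [Fintype X] in
theorem realLoopMatrix_mulVec_injective {T : Finset E} {v₀ : V}
    {n : V → E → ℤ} (hn : G.IsFlow T v₀ n) :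
    Function.Injective (G.realLoopMatrix n T).mulVec := by
  intro u u' h
  ext f
  have := congrFun h f
  simpa [mulVec, dotProduct, realLoopMatrix, loopMatrix_off hn f.2, Subtype.val_inj] using this

omit [Fintype X] in
/-- If the loop matrix has full rank on a set of rows, the other lines are acyclic. -/
theorem isAcyclic_of_injective {ι : Type*} [Fintype ι] {T : Finset E} (hT : G.IsSpanningTree T)
    {v₀ : V} {n : V → E → ℤ} (hn : G.IsFlow T v₀ n) {f : ι → E}
    (h : Function.Injective ((G.realLoopMatrix n T).submatrix f id).mulVec) :
    G.IsAcyclic (univ.image f)ᶜ := by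
  intro k hk hd
  have h0 : (fun e : {e // e ∉ T} => k e) = 0 := by
    refine h ?_
    ext i
    have := realLoopMatrix_mulVec_restrict hT hn hd (f i)
    rw [hk (f i) (by simp)] at this
    rw [mulVec_zero]
    exact this
  ext e
  rw [← realLoopMatrix_mulVec_restrict hT hn hd e, h0, mulVec_zero]

omit [Fintype X] in
/-- The maximal minors of the loop matrix are `±1` on the complements of the spanning trees: the
loop matrices of two spanning trees invert each other over the integers. -/
theorem det_realLoopMatrix_sq_of_isSpanningTree {T : Finset E} {v₀ : V}
    {n : V → E → ℤ} (hn : G.IsFlow T v₀ n) {f : {e // e ∉ T} → E} (hf : Function.Injective f)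
    (hf' : G.IsSpanningTree (univ.image f)ᶜ) :
    ((G.realLoopMatrix n T).submatrix f id).det ^ 2 = 1 := by
  obtain ⟨n', hn'⟩ := exists_isFlow hf'.1 v₀
  let B : Matrix {e // e ∉ T} {e // e ∉ T} ℤ := of fun i j => G.loopMatrix n (f i) j
  let C : Matrix {e // e ∉ T} {e // e ∉ T} ℤ := of fun i j => G.loopMatrix n' i (f j)
  have hCB : C * B = 1 := by
    ext i j
    have h := eq_sum_loopMatrix_add hf' hn' (fun e => G.loopMatrix n e j) i
    simp only [div_loopMatrix hn, smul_zero, Finset.sum_const_zero, add_zero] at h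
    rw [loopMatrix_off hn i.2] at h
    rw [Matrix.mul_apply, Matrix.one_apply]
    simp only [Subtype.val_inj] at h
    rw [h]
    let g : {e // e ∉ T} ≃ {e // e ∉ (univ.image f)ᶜ} :=
      (Equiv.ofInjective f hf).trans (Equiv.subtypeEquivRight fun e => by simp)
    rw [← g.sum_comp]
    rfl
  have hdet : C.det * B.det = 1 := by rw [← det_mul, hCB, det_one]
  have hcast : ((G.realLoopMatrix n T).submatrix f id).det = (B.det : ℝ) :=
    (Int.cast_det (R := ℝ) B).symm
  have hunit : B.det ^ 2 = 1 := by
    rcases Int.isUnit_iff.1 (IsUnit.of_mul_eq_one_right _ hdet) with h | h <;> rw [h] <;> norm_num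
  rw [hcast]
  exact_mod_cast hunit

omit [Fintype X] in
open Classical in
theorem det_realLoopMatrix_sq {T : Finset E} (hT : G.IsSpanningTree T) {v₀ : V}
    {n : V → E → ℤ} (hn : G.IsFlow T v₀ n) {f : {e // e ∉ T} → E} (hf : Function.Injective f) :
    ((G.realLoopMatrix n T).submatrix f id).det ^ 2 =
      if G.IsSpanningTree (univ.image f)ᶜ then 1 else 0 := by
  split_ifs with h
  · exact det_realLoopMatrix_sq_of_isSpanningTree hn hf h
  · by_contra hne
    have hdet : ((G.realLoopMatrix n T).submatrix f id).det ≠ 0 := fun h0 => hne (by simp [h0])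
    have : Nonempty V := ⟨v₀⟩
    refine h (IsAcyclic.isSpanningTree (isAcyclic_of_injective hT hn
      (mulVec_injective_of_isUnit ((Matrix.isUnit_iff_isUnit_det _).2 hdet.isUnit))) ?_)
    rw [card_compl, card_image_of_injective _ hf, card_univ]
    have := card_compl_tree hT
    have := hT.2
    omega

omit [Fintype X] in
theorem symanzikU_eq_det {T : Finset E} (hT : G.IsSpanningTree T) {v₀ : V}
    {n : V → E → ℤ} (hn : G.IsFlow T v₀ n) (β : E → ℝ) :
    G.symanzikU β = ((G.realLoopMatrix n T)ᵀ * diagonal β * G.realLoopMatrix n T).det := by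
  classical
  rw [SchwingerGaussian.det_transpose_mul_diagonal_mul _ _
    (fun S => if G.IsSpanningTree Sᶜ then 1 else 0) fun f hf => by
      rw [det_realLoopMatrix_sq hT hn hf]]
  simp only [mul_ite, mul_one, mul_zero]
  rw [← Finset.sum_filter, symanzikU]
  refine Finset.sum_nbij' compl compl ?_ ?_ (by simp) (by simp) (by simp)
  · intro S hS
    simp only [mem_filter, mem_univ, true_and] at hS
    have h1 := card_compl_tree hT
    have h2 := hS.2
    simp only [mem_filter, mem_powersetCard, subset_univ, true_and, compl_compl, hS, and_true,
      card_compl]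
    omega
  · intro S hS
    simp only [mem_filter, mem_univ, true_and] at hS ⊢
    exact hS.2

/-- The momentum that a spanning tree carries through one of its lines is, up to sign, the external
momentum on one side of the line. -/
theorem sq_eq_of_tree {T : Finset E} (hT : G.IsSpanningTree T) (v₀ : V) {r : E} (hr : r ∈ T)
    {p : X → ℝ} {k : E → ℝ} (hk : ∀ v, G.div k v = -G.external p v) (h0 : ∀ e ∉ T, k e = 0) :
    k r ^ 2 = (open Classical in
      ∑ x : X with (G.lineGraph (T.erase r)).Reachable v₀ (G.vert (Sum.inr x)), p x) ^ 2 := by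
  classical
  set w : V → ℤ := fun v => if (G.lineGraph (T.erase r)).Reachable v₀ v then 1 else 0 with hw
  have h1 := G.sum_zsmul_div w k
  have h2 : ∑ v, w v • G.div k v =
      -∑ x : X with (G.lineGraph (T.erase r)).Reachable v₀ (G.vert (Sum.inr x)), p x := by
    simp only [hk, smul_neg, Finset.sum_neg_distrib]
    rw [sum_zsmul_external, Finset.sum_filter]
    simp [hw]
  have h3 : ∑ e, (w (G.tgt e) - w (G.src e)) • k e = (w (G.tgt r) - w (G.src r)) • k r := by
    refine Finset.sum_eq_single r (fun e _ hne => ?_) (by simp)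
    by_cases he : e ∈ T
    · simp [hw, reachable_tgt_iff (mem_erase.2 ⟨hne, he⟩)]
    · rw [h0 e he, smul_zero]
  have h4 : (w (G.tgt r) - w (G.src r)) ^ 2 = 1 := by
    by_cases hiff : (G.lineGraph (T.erase r)).Reachable v₀ (G.src r) ↔
        (G.lineGraph (T.erase r)).Reachable v₀ (G.tgt r)
    · exfalso
      have hc := card_le_of_connected (lineGraph_connected_of_forall v₀
        (forall_of_lineGraph_connected hT.1
          (P := fun v => (G.lineGraph (T.erase r)).Reachable v₀ v) (fun e he => by
            by_cases hne : e = r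
            · rw [hne]; exact hiff
            · exact (reachable_tgt_iff (mem_erase.2 ⟨hne, he⟩) v₀).symm)
          (SimpleGraph.Reachable.refl v₀)))
      have := hT.2
      have := card_erase_add_one hr
      omega
    · simp only [hw]
      by_cases ha : (G.lineGraph (T.erase r)).Reachable v₀ (G.src r) <;>
        by_cases hb : (G.lineGraph (T.erase r)).Reachable v₀ (G.tgt r) <;>
        simp [ha, hb] at hiff ⊢
  rw [h2, h3, zsmul_eq_mul] at h1
  have h5 : ((w (G.tgt r) - w (G.src r) : ℤ) : ℝ) ^ 2 = 1 := by exact_mod_cast h4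
  calc k r ^ 2 = (((w (G.tgt r) - w (G.src r) : ℤ) : ℝ) * k r) ^ 2 := by rw [mul_pow, h5, one_mul]
    _ = _ := by rw [← h1, neg_sq]

omit [Fintype X] in
/-- An acyclic set with two fewer lines than there are vertices is a 2-tree. -/
theorem IsAcyclic.isTwoTree {T : Finset E} (hT : G.IsSpanningTree T) (v₀ : V)
    {S : Finset E} (hS : G.IsAcyclic S) (hc : #S + 2 = Nat.card V) : G.IsTwoTree S := by
  classical
  obtain ⟨r, hr⟩ : ∃ r, ¬((G.lineGraph S).Reachable v₀ (G.src r) ↔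
      (G.lineGraph S).Reachable v₀ (G.tgt r)) := by
    by_contra! h
    have := card_le_of_connected (lineGraph_connected_of_forall v₀
      (forall_of_lineGraph_connected hT.1 (P := fun v => (G.lineGraph S).Reachable v₀ v)
        (fun e _ => h e) (SimpleGraph.Reachable.refl v₀)))
    omega
  have hrS : r ∉ S := fun h => hr (reachable_tgt_iff h v₀).symm
  have : Nonempty V := ⟨v₀⟩
  refine ⟨insert r S, IsAcyclic.isSpanningTree (fun k hk hd => ?_) ?_, r, mem_insert_self r S,
    (erase_insert hrS).symm⟩
  · have hkr : k r = 0 := by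
      have h1 := G.sum_zsmul_div
        (fun v => if (G.lineGraph S).Reachable v₀ v then 1 else 0) k
      simp only [hd, smul_zero, Finset.sum_const_zero] at h1
      rw [Finset.sum_eq_single r] at h1
      · by_cases ha : (G.lineGraph S).Reachable v₀ (G.src r) <;>
          by_cases hb : (G.lineGraph S).Reachable v₀ (G.tgt r) <;>
          simp [ha, hb] at hr h1 <;> linarith
      · intro e _ hne
        by_cases he : e ∈ S
        · simp [reachable_tgt_iff he]
        · rw [hk e (by simp [hne, he]), smul_zero]
      · simp
    refine hS k (fun e he => ?_) hd
    by_cases hne : e = r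
    · rw [hne, hkr]
    · exact hk e (by simp [hne, he])
  · rw [card_insert_of_notMem hrS]
    omega

/-- The bordered loop matrix, with the momenta of the tree as last column. -/
def borderedMatrix (G : RibbonGraph V E X) (n : V → E → ℤ) (T : Finset E) (p : X → ℝ) :
    Matrix E ({f // f ∉ T} ⊕ Unit) ℝ :=
  fromCols (G.realLoopMatrix n T) (replicateCol Unit (G.treeMomenta n p))

/-- A maximal minor of the bordered matrix, when the rows other than the last are the lines off a
spanning tree: a column operation turns the border into the momenta of that tree. -/
theorem det_borderedMatrix_sq_of_isSpanningTree {T : Finset E} {v₀ : V} {n : V → E → ℤ}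
    (hn : G.IsFlow T v₀ n) {p : X → ℝ} (hp : ∑ x, p x = 0)
    {g : {e // e ∉ T} ⊕ Unit → E} (hg : Function.Injective g)
    (hg' : G.IsSpanningTree (univ.image (g ∘ Sum.inl))ᶜ) :
    ((G.borderedMatrix n T p).submatrix g id).det ^ 2 = (open Classical in
      ∑ x : X with (G.lineGraph (univ.image g)ᶜ).Reachable v₀ (G.vert (Sum.inr x)), p x) ^ 2 := by
  classical
  have hf : Function.Injective (g ∘ Sum.inl) := hg.comp Sum.inl_injective
  set r := g (Sum.inr ()) with hr
  set A := (G.realLoopMatrix n T).submatrix (g ∘ Sum.inl) id with hA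
  have hA2 : A.det ^ 2 = 1 := det_realLoopMatrix_sq_of_isSpanningTree hn hf hg'
  have hAu : IsUnit A.det := by
    rw [isUnit_iff_ne_zero]; intro h; rw [h] at hA2; norm_num at hA2
  have : Invertible A := A.invertibleOfIsUnitDet hAu
  set b : {e // e ∉ T} → ℝ := fun i => G.treeMomenta n p (g (Sum.inl i)) with hb
  set q : {e // e ∉ T} → ℝ := -(A⁻¹ *ᵥ b) with hq
  set k : E → ℝ := fun e =>
    (∑ f : {f // f ∉ T}, G.loopMatrix n e f • q f) + G.treeMomenta n p e with hk
  have hkd : ∀ v, G.div k v = -G.external p v := div_sum_loopMatrix_add_treeMomenta hn hp q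
  have hk0 : ∀ e ∉ (univ.image (g ∘ Sum.inl))ᶜ, k e = 0 := by
    intro e he
    simp only [mem_compl, mem_image, mem_univ, true_and, not_not] at he
    obtain ⟨i, rfl⟩ := he
    have h1 : A *ᵥ q = -b := by
      rw [hq, mulVec_neg, mulVec_mulVec, mul_nonsing_inv _ hAu, one_mulVec]
    have h2 := congrFun h1 i
    simp only [mulVec, dotProduct, hA, submatrix_apply, id, realLoopMatrix, of_apply] at h2
    simp only [hk, zsmul_eq_mul, h2]
    simp [hb]
  have hrT : r ∈ (univ.image (g ∘ Sum.inl))ᶜ := by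
    simp only [mem_compl, mem_image, mem_univ, true_and, not_exists]
    intro i hi
    exact Sum.inl_ne_inr (hg hi)
  have himage : (univ.image g)ᶜ = (univ.image (g ∘ Sum.inl))ᶜ.erase r := by
    ext e
    simp only [mem_compl, mem_image, mem_univ, true_and, mem_erase, Sum.exists, not_or,
      Function.comp_apply, hr]
    constructor
    · rintro ⟨h1, h2⟩
      exact ⟨fun h => h2 ⟨(), h.symm⟩, h1⟩
    · rintro ⟨h1, h2⟩
      exact ⟨h2, fun ⟨_, h⟩ => h1 h.symm⟩
  rw [himage, ← sq_eq_of_tree hg' v₀ hrT hkd hk0]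
  have hblock : (G.borderedMatrix n T p).submatrix g id =
      fromBlocks A (replicateCol Unit b)
        (replicateRow Unit fun f => G.realLoopMatrix n T r f)
        (of fun _ _ => G.treeMomenta n p r) := by
    ext i j
    rcases i with i | ⟨⟩ <;> rcases j with j | ⟨⟩ <;> rfl
  rw [hblock, det_fromBlocks₁₁, mul_pow, hA2, one_mul, det_unique]
  congr 1
  rw [Matrix.mul_assoc]
  simp only [Matrix.sub_apply, of_apply, invOf_eq_nonsing_inv, hk, hq, realLoopMatrix,
    Matrix.mul_apply, replicateRow_apply, zsmul_eq_mul, Pi.neg_apply, mul_neg,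
    Finset.sum_neg_distrib, mulVec, dotProduct, replicateCol_apply]
  ring

theorem det_borderedMatrix_sq {T : Finset E} (hT : G.IsSpanningTree T) {v₀ : V}
    {n : V → E → ℤ} (hn : G.IsFlow T v₀ n) {p : X → ℝ} (hp : ∑ x, p x = 0)
    {g : {e // e ∉ T} ⊕ Unit → E} (hg : Function.Injective g) :
    ((G.borderedMatrix n T p).submatrix g id).det ^ 2 = (open Classical in
      if G.IsTwoTree (univ.image g)ᶜ then
        (∑ x : X with (G.lineGraph (univ.image g)ᶜ).Reachable v₀ (G.vert (Sum.inr x)), p x) ^ 2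
      else 0) := by
  classical
  split_ifs with h
  · obtain ⟨T', hT', r, hr, hS⟩ := h
    obtain ⟨i, hi⟩ : ∃ i, g i = r := by
      have : r ∉ (univ.image g)ᶜ := by rw [hS]; simp
      simpa only [mem_compl, mem_image, mem_univ, true_and, not_not] using this
    -- reorder the rows so that the last one is the line removed from the tree
    let σ : Equiv.Perm ({e // e ∉ T} ⊕ Unit) := Equiv.swap i (Sum.inr ())
    have hσi : univ.image (g ∘ σ) = univ.image g := by
      rw [← image_image, image_univ_equiv]
    have hdet : ((G.borderedMatrix n T p).submatrix (g ∘ σ) id).det ^ 2 =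
        ((G.borderedMatrix n T p).submatrix g id).det ^ 2 := by
      have h1 := det_permute σ ((G.borderedMatrix n T p).submatrix g id)
      rw [submatrix_submatrix, Function.comp_id] at h1
      rw [h1, mul_pow]
      have : ((Equiv.Perm.sign σ : ℤ) : ℝ) ^ 2 = 1 := by
        rcases Int.units_eq_one_or (Equiv.Perm.sign σ) with h | h <;> simp [h]
      rw [this, one_mul]
    have hgr : (g ∘ σ) (Sum.inr ()) = r := by simp [σ, hi]
    have hinj : Function.Injective (g ∘ σ) := hg.comp σ.injective
    have htree : (univ.image ((g ∘ σ) ∘ Sum.inl))ᶜ = T' := by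
      rw [← insert_erase hr, ← hS, ← hσi]
      ext e
      simp only [mem_compl, mem_image, mem_univ, true_and, mem_insert, Sum.exists, not_or]
      constructor
      · intro h1
        by_cases he : e = r
        · exact Or.inl he
        · exact Or.inr ⟨h1, fun ⟨_, h2⟩ => he (by rw [← h2, ← hgr])⟩
      · rintro (he | ⟨h1, -⟩)
        · rintro ⟨j, hj⟩
          rw [he, ← hgr] at hj
          exact Sum.inl_ne_inr (hinj hj)
        · exact h1
    have := det_borderedMatrix_sq_of_isSpanningTree hn hp hinj (by rw [htree]; exact hT')
    rw [hdet, hσi] at this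
    rw [this]
  · by_contra hne
    have hdet : ((G.borderedMatrix n T p).submatrix g id).det ≠ 0 := fun h0 => hne (by simp [h0])
    have hinj := mulVec_injective_of_isUnit ((Matrix.isUnit_iff_isUnit_det _).2 hdet.isUnit)
    refine h (IsAcyclic.isTwoTree hT v₀ (isAcyclic_of_injective hT hn (f := g) ?_) ?_)
    · intro u u' huu
      have h1 : ∀ u : {e // e ∉ T} → ℝ,
          (G.borderedMatrix n T p).submatrix g id *ᵥ Sum.elim u 0 =
            (G.realLoopMatrix n T).submatrix g id *ᵥ u := by
        intro u
        ext i
        simp [mulVec, dotProduct, borderedMatrix]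
      have h2 := @hinj (Sum.elim u 0) (Sum.elim u' 0) (by
        rw [h1, h1]; exact huu)
      ext f
      exact congrFun h2 (Sum.inl f)
    · have h1 : #(univ.image g) = Fintype.card {e // e ∉ T} + 1 := by
        rw [card_image_of_injective _ hg, card_univ, Fintype.card_sum, Fintype.card_unit]
      have h2 := card_compl_tree hT
      have h3 := Finset.card_le_univ (univ.image g)
      rw [card_compl]
      omega

theorem symanzikV_eq_sum_det {D : ℕ} {T : Finset E} (hT : G.IsSpanningTree T) {v₀ : V}
    {n : V → E → ℤ} (hn : G.IsFlow T v₀ n) {p : X → EuclideanSpace ℝ (Fin D)}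
    (hp : ∑ x, p x = 0) (β : E → ℝ) :
    G.symanzikV v₀ p β = ∑ μ, ((G.borderedMatrix n T fun x => p x μ)ᵀ * diagonal β *
      G.borderedMatrix n T fun x => p x μ).det := by
  classical
  have hpμ : ∀ μ, ∑ x, p x μ = 0 := fun μ => by
    have := congrArg (fun w : EuclideanSpace ℝ (Fin D) => w μ) hp
    simpa using this
  have h : ∀ μ, ((G.borderedMatrix n T fun x => p x μ)ᵀ * diagonal β *
      G.borderedMatrix n T fun x => p x μ).det =
      ∑ S : Finset E with G.IsTwoTree S, (∏ e ∈ Sᶜ, β e) *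
        (∑ x : X with (G.lineGraph S).Reachable v₀ (G.vert (Sum.inr x)), p x μ) ^ 2 := by
    intro μ
    rw [SchwingerGaussian.det_transpose_mul_diagonal_mul _ _
      (fun S => if G.IsTwoTree Sᶜ then
        (∑ x : X with (G.lineGraph Sᶜ).Reachable v₀ (G.vert (Sum.inr x)), p x μ) ^ 2 else 0)
      fun g hg => by rw [det_borderedMatrix_sq hT hn (hpμ μ) hg]]
    simp only [mul_ite, mul_zero]
    rw [← Finset.sum_filter]
    symm
    refine Finset.sum_nbij' compl compl ?_ ?_ (by simp) (by simp) (by simp)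
    · intro S hS
      simp only [mem_filter, mem_univ, true_and] at hS
      simp only [mem_filter, mem_powersetCard, subset_univ, true_and, compl_compl, hS, and_true,
        card_compl, Fintype.card_sum, Fintype.card_unit]
      obtain ⟨T', hT', r, hr, rfl⟩ := hS
      have h1 := card_compl_tree hT
      have h2 := hT'.2
      have h3 := card_erase_add_one hr
      have h4 := Finset.card_le_univ T'
      omega
    · intro S hS
      simp only [mem_filter, mem_univ, true_and] at hS ⊢
      exact hS.2
  simp only [h, symanzikV]
  rw [Finset.sum_comm]
  refine Finset.sum_congr rfl fun S _ => ?_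
  rw [← Finset.mul_sum, EuclideanSpace.real_norm_sq_eq]
  simp only [WithLp.ofLp_sum, Finset.sum_apply]
  congr!

/-- The parametric representation of the Gaussian integral over the loop momenta. -/
theorem integral_exp_neg_sum_mul_norm_momenta_sq {D : ℕ} {T : Finset E} (hT : G.IsSpanningTree T)
    (v₀ : V) {p : X → EuclideanSpace ℝ (Fin D)} (hp : ∑ x, p x = 0) {β : E → ℝ}
    (hβ : ∀ e, 0 < β e) :
    ∫ q : {e // e ∉ T} → EuclideanSpace ℝ (Fin D),
      Real.exp (-∑ e, β e * ‖G.momenta T p q e‖ ^ 2) =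
      Real.pi ^ ((D : ℝ) * ((Fintype.card E : ℝ) - Fintype.card V + 1) / 2) *
        (1 / G.symanzikU β ^ ((D : ℝ) / 2) *
          Real.exp (-G.symanzikV v₀ p β / G.symanzikU β)) := by
  obtain ⟨n, hn⟩ := exists_isFlow hT.1 v₀
  have hcard : ((Fintype.card E : ℝ) - Fintype.card V + 1) = Fintype.card {e // e ∉ T} := by
    have := card_compl_tree hT
    rw [Nat.card_eq_fintype_card] at this
    have : ((Fintype.card {e // e ∉ T} + Fintype.card V : ℕ) : ℝ) = (Fintype.card E + 1 : ℕ) := by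
      rw [this]
    push_cast at this
    linarith
  have hk : ∀ μ, (fun e => G.treeMomenta n p e μ) = G.treeMomenta n fun x => p x μ := by
    intro μ
    ext e
    simp [treeMomenta, ← Int.cast_smul_eq_zsmul ℝ]
  simp_rw [momenta_eq hT hn hp]
  rw [SchwingerGaussian.integral_exp_neg_sum_mul_norm_sq _ (realLoopMatrix_mulVec_injective hn) β
    hβ, hcard, symanzikU_eq_det hT hn, symanzikV_eq_sum_det hT hn hp]
  simp only [hk, borderedMatrix, neg_div]

omit [Fintype V] [Fintype X] in
theorem symanzikU_pos {T : Finset E} (hT : G.IsSpanningTree T) {β : E → ℝ}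
    (hβ : ∀ e, 0 < β e) : 0 < G.symanzikU β := by
  classical
  rw [symanzikU]
  refine Finset.sum_pos (fun S _ => Finset.prod_pos fun e _ => hβ e) ⟨T, ?_⟩
  simpa using hT

end RibbonGraph

/-! ### Moyal phases of planar graphs -/

namespace RibbonGraph

open Finset

section MoyalPairing

variable {D : ℕ} (θ : ℝ)

theorem moyalMatrix_antisymm (i j : Fin D) : moyalMatrix D θ i j = -moyalMatrix D θ j i := by
  simp only [moyalMatrix, Matrix.of_apply]
  split_ifs <;> first | omega | simp

theorem moyalPairing_add_left (k k' q : EuclideanSpace ℝ (Fin D)) :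
    moyalPairing θ (k + k') q = moyalPairing θ k q + moyalPairing θ k' q := by
  simp [moyalPairing, add_mul, Finset.sum_add_distrib]

theorem moyalPairing_antisymm (k q : EuclideanSpace ℝ (Fin D)) :
    moyalPairing θ k q = -moyalPairing θ q k := by
  rw [moyalPairing, moyalPairing, Finset.sum_comm, ← Finset.sum_neg_distrib]
  refine Finset.sum_congr rfl fun i _ => ?_
  rw [← Finset.sum_neg_distrib]
  refine Finset.sum_congr rfl fun j _ => ?_
  rw [moyalMatrix_antisymm]
  ring

theorem moyalPairing_self (k : EuclideanSpace ℝ (Fin D)) : moyalPairing θ k k = 0 := by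
  have := moyalPairing_antisymm θ k k
  linarith

theorem moyalPairing_neg_right (k q : EuclideanSpace ℝ (Fin D)) :
    moyalPairing θ k (-q) = -moyalPairing θ k q := by
  simp [moyalPairing]

theorem moyalPairing_zero_left (q : EuclideanSpace ℝ (Fin D)) : moyalPairing θ 0 q = 0 := by
  simp [moyalPairing]

theorem moyalPairing_zero_right (q : EuclideanSpace ℝ (Fin D)) : moyalPairing θ q 0 = 0 := by
  simp [moyalPairing]

theorem moyalPairing_sum_left {ι : Type*} (s : Finset ι) (k : ι → EuclideanSpace ℝ (Fin D))
    (q : EuclideanSpace ℝ (Fin D)) :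
    moyalPairing θ (∑ i ∈ s, k i) q = ∑ i ∈ s, moyalPairing θ (k i) q := by
  classical
  induction s using Finset.induction_on with
  | empty => simp [moyalPairing_zero_left]
  | insert a s ha ih => rw [sum_insert ha, sum_insert ha, moyalPairing_add_left, ih]

theorem moyalPairing_sum_right {ι : Type*} (s : Finset ι) (k : ι → EuclideanSpace ℝ (Fin D))
    (q : EuclideanSpace ℝ (Fin D)) :
    moyalPairing θ q (∑ i ∈ s, k i) = ∑ i ∈ s, moyalPairing θ q (k i) := by
  rw [moyalPairing_antisymm, moyalPairing_sum_left, ← Finset.sum_neg_distrib]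
  exact Finset.sum_congr rfl fun i _ => (moyalPairing_antisymm θ _ _).symm

end MoyalPairing

section Cycles

variable {H : Type*} [Fintype H] (τ : Equiv.Perm H)

variable {τ} in
theorem eq_of_sameCycle {α : Type*} {F : H → α} (hF : ∀ h, F (τ h) = F h) {x y : H}
    (h : τ.SameCycle x y) : F x = F y := by
  obtain ⟨i, rfl⟩ := h.exists_nat_pow_eq
  induction i with
  | zero => rfl
  | succ i ih => rw [pow_succ', Equiv.Perm.mul_apply, hF]; exact ih ⟨i, by simp⟩

/-- Reading the cycle of `h₀` once. -/
theorem sum_range_minimalPeriod {M : Type*} [AddCommMonoid M] (h₀ : H) (f : H → M) :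
    ∑ j ∈ range (Function.minimalPeriod τ h₀), f ((τ ^ j) h₀) =
      (open Classical in ∑ h : H with τ.SameCycle h₀ h, f h) := by
  classical
  refine Finset.sum_bij (fun j _ => (τ ^ j) h₀) ?_ ?_ ?_ (fun _ _ => rfl)
  · intro j _
    simp only [mem_filter, mem_univ, true_and]
    exact ⟨j, by simp⟩
  · intro i hi j hj hij
    simp only [← Equiv.Perm.iterate_eq_pow] at hij
    exact Function.iterate_injOn_Iio_minimalPeriod (by simpa using hi) (by simpa using hj) hij
  · intro h hh
    simp only [mem_filter, mem_univ, true_and] at hh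
    obtain ⟨i, rfl⟩ := hh.exists_nat_pow_eq
    have hpos : 0 < Function.minimalPeriod τ h₀ :=
      Function.minimalPeriod_pos_of_mem_periodicPts
        (τ.injective.mem_periodicPts h₀)
    refine ⟨i % Function.minimalPeriod τ h₀, by simpa using Nat.mod_lt _ hpos, ?_⟩
    simp only [← Equiv.Perm.iterate_eq_pow]
    exact Function.iterate_mod_minimalPeriod_eq

/-- A Moyal phase in terms of a potential `P` whose increments along the cycle are the momenta. -/
theorem moyalPhase_eq_of_potential {D : ℕ} (θ : ℝ) (h₀ : H) {K P : H → EuclideanSpace ℝ (Fin D)}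
    (hP : ∀ h, P (τ h) = P h + K h)
    (hK : (open Classical in ∑ h : H with τ.SameCycle h₀ h, K h) = 0) :
    moyalPhase θ τ h₀ K = Complex.exp (-(Complex.I / 2) *
      ((open Classical in ∑ h : H with τ.SameCycle h₀ h, moyalPairing θ (P h) (K h) : ℝ) : ℂ)) := by
  have hsum : ∀ j : ℕ, P ((τ ^ j) h₀) = P h₀ + ∑ i ∈ range j, K ((τ ^ i) h₀) := by
    intro j
    induction j with
    | zero => simp
    | succ j ih => rw [pow_succ', Equiv.Perm.mul_apply, hP, ih, sum_range_succ, add_assoc]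
  rw [moyalPhase]
  congr 3
  rw [← sum_range_minimalPeriod τ h₀ fun h => moyalPairing θ (P h) (K h)]
  have h0 : moyalPairing θ (P h₀)
      (∑ j ∈ range (Function.minimalPeriod τ h₀), K ((τ ^ j) h₀)) = 0 := by
    rw [sum_range_minimalPeriod τ h₀ K, hK, moyalPairing_zero_right]
  simp only [hsum, moyalPairing_add_left, Finset.sum_add_distrib, ← moyalPairing_sum_right, h0,
    zero_add, moyalPairing_sum_left]

/-- A function whose sums along the cycles of `σ` vanish is a coboundary. -/
theorem exists_apply_eq_add {M : Type*} [AddCommGroup M] [Module ℝ M] (σ : Equiv.Perm H)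
    (g : H → M) (hg : ∀ h, ∑ i ∈ range (orderOf σ), g ((σ ^ i) h) = 0) :
    ∃ R : H → M, ∀ h, R (σ h) = R h + g h := by
  -- averaging the partial sums over all starting points avoids choosing one on each cycle
  refine ⟨fun h => (orderOf σ : ℝ)⁻¹ • ∑ i ∈ range (orderOf σ), (i : ℝ) • g ((σ ^ i) h),
    fun h => ?_⟩
  have hN : (orderOf σ : ℝ) ≠ 0 := by exact_mod_cast (orderOf_pos σ).ne'
  have h1 := sum_range_succ (fun i : ℕ => (i : ℝ) • g ((σ ^ i) h)) (orderOf σ)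
  rw [sum_range_succ', pow_orderOf_eq_one] at h1
  have h2 : ∑ i ∈ range (orderOf σ), ((i + 1 : ℕ) : ℝ) • g ((σ ^ (i + 1)) h) =
      ∑ i ∈ range (orderOf σ), (i : ℝ) • g ((σ ^ i) (σ h)) := by
    have h3 := hg (σ h)
    simp only [Nat.cast_add, Nat.cast_one, add_smul, one_smul, Finset.sum_add_distrib, pow_succ,
      Equiv.Perm.mul_apply]
    rw [h3, add_zero]
  simp only [h2, Nat.cast_zero, zero_smul, add_zero, Equiv.Perm.one_apply] at h1
  beta_reduce
  rw [h1, smul_add, inv_smul_smul₀ hN]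

/-- Sums along cycles vanish for a function of total sum zero that lives on a single cycle. -/
theorem sum_range_orderOf_eq_zero {M : Type*} [AddCommGroup M] [Module ℝ M] (σ : Equiv.Perm H)
    {g : H → M} (h₀ : H) (hg : ∀ h, ¬σ.SameCycle h₀ h → g h = 0) (hsum : ∑ h, g h = 0) (h : H) :
    ∑ i ∈ range (orderOf σ), g ((σ ^ i) h) = 0 := by
  classical
  set A : H → M := fun h => ∑ i ∈ range (orderOf σ), g ((σ ^ i) h) with hA
  have hinv : ∀ h, A (σ h) = A h := by
    intro h
    have h1 := sum_range_succ (fun i : ℕ => g ((σ ^ i) h)) (orderOf σ)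
    rw [sum_range_succ', pow_orderOf_eq_one, pow_zero, add_left_inj] at h1
    simpa [hA, pow_succ] using h1
  have hoff : ∀ h, ¬σ.SameCycle h₀ h → A h = 0 := by
    intro h hh
    refine Finset.sum_eq_zero fun i _ => hg _ fun h' => hh ?_
    rwa [Equiv.Perm.sameCycle_pow_right] at h'
  have hon : ∀ h, σ.SameCycle h₀ h → A h = A h₀ := fun h hh => (eq_of_sameCycle hinv hh).symm
  have htot : ∑ h, A h = 0 := by
    rw [hA, Finset.sum_comm]
    refine Finset.sum_eq_zero fun i _ => ?_
    rw [Equiv.sum_comp (σ ^ i) g, hsum]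
  have htot' : ∑ h, A h = (#{h | σ.SameCycle h₀ h} : ℝ) • A h₀ := by
    rw [← Finset.sum_filter_add_sum_filter_not univ (fun h => σ.SameCycle h₀ h),
      Finset.sum_eq_zero (s := univ.filter fun h => ¬σ.SameCycle h₀ h)
        (fun h hh => hoff h (mem_filter.1 hh).2), add_zero,
      Finset.sum_congr rfl (fun h hh => hon h (mem_filter.1 hh).2), Finset.sum_const,
      Nat.cast_smul_eq_nsmul]
  have hA0 : A h₀ = 0 := by
    rw [htot, eq_comm, smul_eq_zero] at htot'
    refine htot'.resolve_left ?_
    have : h₀ ∈ ({h | σ.SameCycle h₀ h} : Finset H) := by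
      simp [Equiv.Perm.SameCycle.refl]
    exact_mod_cast (card_pos.2 ⟨h₀, this⟩).ne'
  by_cases hh : σ.SameCycle h₀ h
  · exact (hon h hh).trans hA0
  · exact hoff h hh

end Cycles

section Faces

variable {V E X : Type*} {G : RibbonGraph V E X}

theorem flip_flip (h : (E × Bool) ⊕ X) : flip E X (flip E X h) = h := by
  rcases h with ⟨e, b⟩ | x <;> simp [flip]

@[simp]
theorem flip_true (e : E) : flip E X (Sum.inl (e, true)) = Sum.inl (e, false) := rfl

@[simp]
theorem flip_false (e : E) : flip E X (Sum.inl (e, false)) = Sum.inl (e, true) := rfl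

@[simp]
theorem flip_inr (x : X) : flip E X (Sum.inr x) = Sum.inr x := rfl

theorem facePerm_rot_symm (h : (E × Bool) ⊕ X) : G.facePerm (G.rot.symm h) = flip E X h := by
  simp [facePerm]

/-- The face on the boundary of which the half-edge `h` lies. -/
abbrev faceOf (G : RibbonGraph V E X) (h : (E × Bool) ⊕ X) : G.Face :=
  Quotient.mk (Equiv.Perm.SameCycle.setoid G.facePerm) h

theorem faceOf_facePerm (h : (E × Bool) ⊕ X) : G.faceOf (G.facePerm h) = G.faceOf h :=
  Quotient.sound (Equiv.Perm.sameCycle_apply_left.2 (Equiv.Perm.SameCycle.refl _ _))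

/-- The corner after the other end of a line lies on the same face as the corner before this end. -/
theorem faceOf_flip (h : (E × Bool) ⊕ X) : G.faceOf (flip E X h) = G.faceOf (G.rot.symm h) := by
  rw [← facePerm_rot_symm, faceOf_facePerm]

theorem vert_rot (h : (E × Bool) ⊕ X) : G.vert (G.rot h) = G.vert h :=
  (G.sameCycle_iff _ _).1 (Equiv.Perm.sameCycle_apply_left.2 (Equiv.Perm.SameCycle.refl _ _))

theorem vert_rot_symm (h : (E × Bool) ⊕ X) : G.vert (G.rot.symm h) = G.vert h := by
  rw [← vert_rot, Equiv.apply_symm_apply]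

variable [Fintype E] [Fintype X]

theorem sum_vert_sub_rot_symm {M : Type*} [AddCommGroup M] (Q : (E × Bool) ⊕ X → M) (v : V) :
    (open Classical in ∑ h : (E × Bool) ⊕ X with G.vert h = v, (Q h - Q (G.rot.symm h))) = 0 := by
  classical
  rw [Finset.sum_sub_distrib, sub_eq_zero]
  refine Finset.sum_bij' (fun h _ => G.rot h) (fun h _ => G.rot.symm h) ?_ ?_ ?_ ?_ ?_ <;>
    simp [vert_rot, vert_rot_symm]

/-- The coboundary of a face potential: on each line, the difference of the values on its two
sides. -/
def faceCoboundary (G : RibbonGraph V E X) : (G.Face → ℝ) →ₗ[ℝ] (E → ℝ) where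
  toFun f e := f (G.faceOf (Sum.inl (e, true))) - f (G.faceOf (Sum.inl (e, false)))
  map_add' f g := by ext e; simp; ring
  map_smul' c f := by ext e; simp; ring

/-- The real circulations. -/
def circulations (G : RibbonGraph V E X) : Submodule ℝ (E → ℝ) where
  carrier := {k | ∀ v, G.div k v = 0}
  add_mem' {k k'} hk hk' v := by
    have := G.div_add k k' v
    exact this.trans (by rw [hk v, hk' v, add_zero])
  zero_mem' v := by simp [div]
  smul_mem' c k hk v := by
    have := G.div_map (AddMonoidHom.mulLeft c) k v
    exact this.trans (by rw [hk v, map_zero])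

theorem sum_vert_eq_div {M : Type*} [AddCommGroup M] (K : (E × Bool) ⊕ X → M)
    (hK : ∀ e, K (Sum.inl (e, false)) = -K (Sum.inl (e, true))) (v : V) :
    (open Classical in ∑ h : (E × Bool) ⊕ X with G.vert h = v, K h) =
      G.div (fun e => K (Sum.inl (e, true))) v + G.external (fun x => K (Sum.inr x)) v := by
  classical
  rw [Finset.sum_filter, Fintype.sum_sum_type, Fintype.sum_prod_type, external,
    Finset.sum_filter, div]
  simp only [Fintype.sum_bool, tgt, src]
  have h : ∀ e : E, ((if G.vert (Sum.inl (e, true)) = v then K (Sum.inl (e, true)) else 0) +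
      if G.vert (Sum.inl (e, false)) = v then K (Sum.inl (e, false)) else 0) =
      (if G.vert (Sum.inl (e, true)) = v then K (Sum.inl (e, true)) else 0) -
      if G.vert (Sum.inl (e, false)) = v then K (Sum.inl (e, true)) else 0 := fun e => by
    rw [hK]; split_ifs <;> simp [sub_eq_add_neg]
  simp only [h]
  congr!

theorem faceCoboundary_mem (f : G.Face → ℝ) : G.faceCoboundary f ∈ G.circulations := by
  intro v
  have h := sum_vert_eq_div (G := G)
    (fun h => f (G.faceOf h) - f (G.faceOf (flip E X h))) (by simp) v
  simp only [faceOf_flip] at h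
  rw [sum_vert_sub_rot_symm (fun h => f (G.faceOf h))] at h
  simp only [← faceOf_flip, flip_true, flip_inr, sub_self] at h
  rw [h]
  simp [external, faceCoboundary]

/-- On a connected graph only the constant face potentials have coboundary zero. -/
theorem faceCoboundary_ker {S : Finset E} (hS : (G.lineGraph S).Connected) :
    Module.finrank ℝ (LinearMap.ker G.faceCoboundary) ≤ 1 := by
  refine finrank_le_one ⟨fun _ => 1, by ext; simp [faceCoboundary]⟩ ?_
  rintro ⟨f, hf⟩
  obtain ⟨v₀⟩ := hS.nonempty
  have hflip : ∀ h, f (G.faceOf (flip E X h)) = f (G.faceOf h) := by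
    have h1 : ∀ e, f (G.faceOf (Sum.inl (e, true))) = f (G.faceOf (Sum.inl (e, false))) :=
      fun e => sub_eq_zero.1 (congrFun (LinearMap.mem_ker.1 hf) e)
    rintro (⟨e, _ | _⟩ | x)
    · exact h1 e
    · exact (h1 e).symm
    · rfl
  have hrot : ∀ h, f (G.faceOf (G.rot h)) = f (G.faceOf h) := by
    intro h
    rw [← hflip (G.rot h), faceOf_flip, Equiv.symm_apply_apply]
  have hvert : ∀ h h', G.vert h = G.vert h' → f (G.faceOf h) = f (G.faceOf h') := fun h h' hh =>
    eq_of_sameCycle (F := fun h => f (G.faceOf h)) hrot ((G.sameCycle_iff h h').2 hh)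
  refine ⟨f (G.faceOf (G.base v₀)), ?_⟩
  ext φ
  obtain ⟨h, rfl⟩ := Quotient.exists_rep φ
  have key := forall_of_lineGraph_connected hS
    (P := fun v => f (G.faceOf (G.base v₀)) = f (G.faceOf (G.base v))) (fun e _ => by
      rw [hvert (G.base (G.src e)) (Sum.inl (e, false)) (G.vert_base _),
        hvert (G.base (G.tgt e)) (Sum.inl (e, true)) (G.vert_base _), ← flip_true, hflip]) rfl
    (G.vert h)
  change f (G.faceOf (G.base v₀)) * 1 = f (G.faceOf h)
  rw [mul_one, key]
  exact hvert _ _ (G.vert_base _)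

variable [DecidableEq E] [Fintype V]

/-- In genus zero every circulation is the coboundary of a face potential: by Euler's formula the
coboundaries fill the space of circulations. -/
theorem range_faceCoboundary (hG : G.HasGenus 0) {T : Finset E} (hT : G.IsSpanningTree T) :
    LinearMap.range G.faceCoboundary = G.circulations := by
  classical
  have : Finite G.Face := Quotient.finite _
  have : Fintype G.Face := Fintype.ofFinite _
  refine Submodule.eq_of_le_of_finrank_le ?_ ?_
  · rintro _ ⟨f, rfl⟩
    exact faceCoboundary_mem f
  · have h1 := LinearMap.finrank_range_add_finrank_ker G.faceCoboundary
    rw [Module.finrank_fintype_fun_eq_card] at h1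
    have h2 := faceCoboundary_ker hT.1
    have h3 : Module.finrank ℝ G.circulations ≤ Fintype.card {e // e ∉ T} := by
      let res : G.circulations →ₗ[ℝ] ({e // e ∉ T} → ℝ) :=
        (LinearMap.funLeft ℝ ℝ Subtype.val).comp G.circulations.subtype
      have hinj : Function.Injective res := by
        refine (injective_iff_map_eq_zero _).2 ?_
        rintro ⟨k, hk⟩ h0
        obtain ⟨v₀⟩ := hT.1.nonempty
        obtain ⟨n, hn⟩ := exists_isFlow hT.1 v₀
        have h0' : ∀ f : {e // e ∉ T}, k f = 0 := fun f => congrFun h0 f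
        ext e
        change k e = 0
        rw [eq_sum_loopMatrix_add hT hn k e]
        simp [h0', hk _]
      have := LinearMap.finrank_le_finrank_of_injective hinj
      rwa [Module.finrank_fintype_fun_eq_card] at this
    have h4 := card_compl_tree hT
    have h5 : (2 : ℤ) - 2 * (0 : ℕ) = (Nat.card V : ℤ) - Nat.card E + Nat.card G.Face := hG
    rw [Nat.card_eq_fintype_card (α := E), Nat.card_eq_fintype_card (α := G.Face)] at h5
    omega

variable {D : ℕ} {p : X → EuclideanSpace ℝ (Fin D)} {k : E → EuclideanSpace ℝ (Fin D)}

/-- The dual momenta of a planar regular graph: a potential on the corners whose differences across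
the half-edges are the momenta, and which jumps along the faces at the external legs only. -/
theorem exists_dual_momenta (hG : G.HasGenus 0) {T : Finset E} (hT : G.IsSpanningTree T)
    (hp : ∑ x, p x = 0) {h₀ : (E × Bool) ⊕ X}
    (hh₀ : ∀ x : X, G.facePerm.SameCycle h₀ (Sum.inr x)) (hk : G.Conserves p k) :
    ∃ Q : (E × Bool) ⊕ X → EuclideanSpace ℝ (Fin D),
      (∀ h, incoming p k h = Q h - Q (G.rot.symm h)) ∧
      ∀ h, Q (flip E X h) = Q (G.rot.symm h) + incoming p 0 (flip E X h) := by
  classical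
  have hJ0 : ∑ h, incoming p (0 : E → EuclideanSpace ℝ (Fin D)) h = 0 := by
    rw [Fintype.sum_sum_type, Fintype.sum_prod_type]
    simp [incoming, hp]
  have hJ1 : ∀ h, ¬G.facePerm.SameCycle h₀ h →
      incoming p (0 : E → EuclideanSpace ℝ (Fin D)) (G.facePerm h) = 0 := by
    intro h hh
    rcases hfh : G.facePerm h with ⟨e, _ | _⟩ | x
    · simp [incoming]
    · simp [incoming]
    · refine absurd ?_ hh
      rw [← Equiv.Perm.sameCycle_apply_right, hfh]
      exact hh₀ x
  have hJ2 : ∑ h, incoming p (0 : E → EuclideanSpace ℝ (Fin D)) (G.facePerm h) = 0 :=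
    (Equiv.sum_comp G.facePerm _).trans hJ0
  obtain ⟨R, hR⟩ := exists_apply_eq_add G.facePerm _
    (sum_range_orderOf_eq_zero G.facePerm h₀ hJ1 hJ2)
  have hRflip : ∀ h, R (flip E X h) = R (G.rot.symm h) + incoming p 0 (flip E X h) := by
    intro h
    rw [← facePerm_rot_symm, hR]
  have hRt : ∀ e, R (G.rot.symm (Sum.inl (e, true))) = R (Sum.inl (e, false)) := fun e => by
    have := hRflip (Sum.inl (e, true))
    simpa [incoming] using this.symm
  have hRf : ∀ e, R (G.rot.symm (Sum.inl (e, false))) = R (Sum.inl (e, true)) := fun e => by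
    have := hRflip (Sum.inl (e, false))
    simpa [incoming] using this.symm
  have hRx : ∀ x, R (Sum.inr x) - R (G.rot.symm (Sum.inr x)) = p x := fun x => by
    have := hRflip (Sum.inr x)
    rw [flip_inr] at this
    rw [this]
    simp [incoming]
  set k₀ : E → EuclideanSpace ℝ (Fin D) :=
    fun e => R (Sum.inl (e, true)) - R (Sum.inl (e, false)) with hk₀
  have hcons : ∀ v, G.div k₀ v = -G.external p v := by
    intro v
    have h := sum_vert_eq_div (G := G) (fun h => R h - R (G.rot.symm h)) (by simp [hRt, hRf]) v
    rw [sum_vert_sub_rot_symm] at h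
    simp only [hRt, hRx] at h
    exact eq_neg_of_add_eq_zero_left h.symm
  have hdiv : ∀ v, G.div (fun e => k e - k₀ e) v = 0 := by
    intro v
    have h1 := G.div_add k₀ (fun e => k e - k₀ e) v
    simp only [add_sub_cancel] at h1
    rw [conserves_iff.1 hk, hcons] at h1
    exact left_eq_add.1 h1
  have hf : ∀ μ, ∃ f : G.Face → ℝ, ∀ e, f (G.faceOf (Sum.inl (e, true))) -
      f (G.faceOf (Sum.inl (e, false))) = k e μ - k₀ e μ := by
    intro μ
    have hmem : (fun e => k e μ - k₀ e μ) ∈ G.circulations := by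
      intro v
      have := G.div_map ((EuclideanSpace.proj (𝕜 := ℝ) μ :
        EuclideanSpace ℝ (Fin D) →L[ℝ] ℝ) : EuclideanSpace ℝ (Fin D) →+ ℝ)
        (fun e => k e - k₀ e) v
      rw [hdiv, map_zero] at this
      exact this
    rw [← range_faceCoboundary hG hT] at hmem
    obtain ⟨f, hf⟩ := hmem
    exact ⟨f, fun e => congrFun hf e⟩
  choose f hf using hf
  let F : G.Face → EuclideanSpace ℝ (Fin D) := fun φ => WithLp.toLp 2 fun μ => f μ φ
  have hF : ∀ e, F (G.faceOf (Sum.inl (e, true))) - F (G.faceOf (Sum.inl (e, false))) =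
      k e - k₀ e := by
    intro e
    ext μ
    simpa [F] using hf μ e
  have hkF : ∀ e, k e = F (G.faceOf (Sum.inl (e, true))) - F (G.faceOf (Sum.inl (e, false))) +
      (R (Sum.inl (e, true)) - R (Sum.inl (e, false))) := fun e => by
    rw [hF, hk₀, sub_add_cancel]
  refine ⟨fun h => R h + F (G.faceOf h), ?_, ?_⟩
  · rintro (⟨e, _ | _⟩ | x) <;> beta_reduce
    · rw [← faceOf_flip, flip_false, hRf]
      simp only [incoming]
      rw [hkF]
      abel
    · rw [← faceOf_flip, flip_true, hRt]
      simp only [incoming]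
      rw [hkF]
      abel
    · rw [← faceOf_flip, flip_inr, add_sub_add_right_eq_sub, hRx]
      rfl
  · intro h
    beta_reduce
    rw [hRflip, faceOf_flip]
    abel

/-- Filk's theorem for planar regular graphs: the phases of the vertices combine to that of a single
vertex with the external legs in the order of the external face.  In terms of the dual momenta the
two ends of each line give opposite contributions. -/
theorem vertexPhase_eq_externalPhase (hG : G.HasGenus 0) {T : Finset E} (hT : G.IsSpanningTree T)
    (θ : ℝ) (hp : ∑ x, p x = 0) {h₀ : (E × Bool) ⊕ X}
    (hh₀ : ∀ x : X, G.facePerm.SameCycle h₀ (Sum.inr x)) (hk : G.Conserves p k) :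
    G.vertexPhase θ p k = G.externalPhase θ h₀ p := by
  classical
  obtain ⟨Q, hQ1, hQ2⟩ := exists_dual_momenta hG hT hp hh₀ hk
  have hcyc : ∀ v, (univ.filter fun h => G.rot.SameCycle (G.base v) h) =
      univ.filter fun h => G.vert h = v := by
    intro v
    ext h
    simp only [mem_filter, mem_univ, true_and, G.sameCycle_iff, G.vert_base, eq_comm]
  have hvert : G.vertexPhase θ p k = Complex.exp (-(Complex.I / 2) *
      ((∑ h, moyalPairing θ (Q (G.rot.symm h)) (incoming p k h) : ℝ) : ℂ)) := by
    rw [vertexPhase, ← Finset.sum_fiberwise (s := univ) G.vert, Complex.ofReal_sum,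
      Finset.mul_sum, Complex.exp_sum]
    refine Finset.prod_congr rfl fun v _ => ?_
    rw [moyalPhase_eq_of_potential G.rot θ (G.base v) (P := fun h => Q (G.rot.symm h))]
    · rw [← hcyc]
      congr!
    · intro h
      rw [Equiv.symm_apply_apply, hQ1]
      abel
    · have := hk v
      rw [← this, ← hcyc]
      congr!
  have hext : G.externalPhase θ h₀ p = Complex.exp (-(Complex.I / 2) *
      ((∑ x, moyalPairing θ (Q (G.rot.symm (Sum.inr x))) (p x) : ℝ) : ℂ)) := by
    have hfs : ∀ h, G.facePerm.symm h = G.rot.symm (flip E X h) := by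
      intro h
      rw [Equiv.symm_apply_eq, facePerm_rot_symm, flip_flip]
    have hoff : ∀ {M : Type} [AddCommMonoid M] (f : (E × Bool) ⊕ X → M),
        (∀ e b, f (Sum.inl (e, b)) = 0) →
        ∑ h : (E × Bool) ⊕ X with G.facePerm.SameCycle h₀ h, f h = ∑ x, f (Sum.inr x) := by
      intro M _ f hf
      rw [Finset.sum_filter, Fintype.sum_sum_type]
      simp [hf, hh₀]
    have hinc : ∀ e b, incoming p (0 : E → EuclideanSpace ℝ (Fin D)) (Sum.inl (e, b)) = 0 := by
      rintro e (_ | _) <;> simp [incoming]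
    rw [externalPhase, moyalPhase_eq_of_potential G.facePerm θ h₀
      (P := fun h => Q (G.facePerm.symm h))]
    · congr 3
      refine Eq.trans ?_ ((hoff (fun h => moyalPairing θ (Q (G.facePerm.symm h))
        (incoming p 0 h)) fun e b => by rw [hinc, moyalPairing_zero_right]).trans ?_)
      · congr!
      · simp only [hfs, flip_inr]
        rfl
    · intro h
      rw [Equiv.symm_apply_apply, hfs]
      have := hQ2 (flip E X h)
      rwa [flip_flip] at this
    · refine Eq.trans ?_ ((hoff (incoming p 0) hinc).trans hp)
      congr!
  rw [hvert, hext]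
  congr 3
  rw [Fintype.sum_sum_type, Fintype.sum_prod_type]
  have hlines : ∀ e : E, ∑ b, moyalPairing θ (Q (G.rot.symm (Sum.inl (e, b))))
      (incoming p k (Sum.inl (e, b))) = 0 := by
    intro e
    have h1 := hQ2 (Sum.inl (e, true))
    have h2 := hQ2 (Sum.inl (e, false))
    have h3 := hQ1 (Sum.inl (e, true))
    simp only [flip_true, flip_false, incoming, Pi.zero_apply, neg_zero, add_zero] at h1 h2 h3
    have h4 : Q (Sum.inl (e, true)) = Q (Sum.inl (e, false)) + k e := by rw [h3, h1]; abel
    rw [Fintype.sum_bool, ← h1, ← h2, h4]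
    simp only [incoming]
    rw [moyalPairing_neg_right, moyalPairing_add_left, moyalPairing_self]
    ring
  simp only [hlines, Finset.sum_const_zero, zero_add]
  rfl

end Faces

end RibbonGraph

/-! ### Schwinger parameters -/

namespace RibbonGraph

open Finset

section Masses

variable {θ m a : ℝ}

theorem sq_pos_of_mass (ha : 0 < a) (ham : a ≤ θ ^ 2 * m ^ 4 / 4) : 0 < θ ^ 2 ∧ 0 < m ^ 2 := by
  constructor <;> refine lt_of_le_of_ne (sq_nonneg _) fun h => ?_
  · rw [← h] at ham; linarith
  · rw [show m ^ 4 = m ^ 2 * m ^ 2 by ring, ← h] at ham; linarith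

theorem massSq_add (ha : 0 < a) (ham : a ≤ θ ^ 2 * m ^ 4 / 4) :
    massSq₁ θ m a + massSq₂ θ m a = m ^ 2 := by
  have h := (sq_pos_of_mass ha ham).1.ne'
  rw [massSq₁, massSq₂, ← add_div, div_eq_iff (by positivity)]
  ring

theorem massSq_mul (ha : 0 < a) (ham : a ≤ θ ^ 2 * m ^ 4 / 4) :
    massSq₁ θ m a * massSq₂ θ m a = a / θ ^ 2 := by
  have h0 := (sq_pos_of_mass ha ham).1
  have hdisc : 0 ≤ θ ^ 4 * m ^ 4 - 4 * θ ^ 2 * a := by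
    have : θ ^ 4 * m ^ 4 - 4 * θ ^ 2 * a = 4 * θ ^ 2 * (θ ^ 2 * m ^ 4 / 4 - a) := by ring
    rw [this]
    exact mul_nonneg (by positivity) (by linarith)
  have hs := Real.mul_self_sqrt hdisc
  rw [massSq₁, massSq₂, div_mul_div_comm, div_eq_div_iff (by positivity) h0.ne']
  linear_combination -θ ^ 2 * hs

theorem massSq_pos (ha : 0 < a) (ham : a ≤ θ ^ 2 * m ^ 4 / 4) :
    0 < massSq₁ θ m a ∧ 0 < massSq₂ θ m a := by
  obtain ⟨hθ, hm⟩ := sq_pos_of_mass ha ham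
  have h2 : 0 < massSq₂ θ m a := by
    rw [massSq₂]
    have := Real.sqrt_nonneg (θ ^ 4 * m ^ 4 - 4 * θ ^ 2 * a)
    positivity
  have h12 : 0 < massSq₁ θ m a * massSq₂ θ m a := by
    rw [massSq_mul ha ham]; positivity
  exact ⟨pos_of_mul_pos_left h12 h2.le, h2⟩

/-- The propagator as the commutative one plus a correction, by partial fractions. -/
theorem ncPropagator_eq (ha : 0 < a) (ham : a ≤ θ ^ 2 * m ^ 4 / 4) {D : ℕ}
    (k : EuclideanSpace ℝ (Fin D)) :
    ncPropagator θ m a k = 1 / (‖k‖ ^ 2 + m ^ 2) *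
      (1 + -(a / θ ^ 2) * (1 / (‖k‖ ^ 2 + massSq₁ θ m a) * (1 / (‖k‖ ^ 2 + massSq₂ θ m a)))) := by
  obtain ⟨hθ, hm⟩ := sq_pos_of_mass ha ham
  obtain ⟨h1, h2⟩ := massSq_pos ha ham
  rw [ncPropagator]
  split_ifs with hk
  · subst hk
    simp only [norm_zero]
    rw [← massSq_mul ha ham]
    field_simp
    ring
  · have hs : 0 < ‖k‖ ^ 2 := by positivity
    have hprod : (‖k‖ ^ 2 + massSq₁ θ m a) * (‖k‖ ^ 2 + massSq₂ θ m a) =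
        ‖k‖ ^ 2 * ‖k‖ ^ 2 + m ^ 2 * ‖k‖ ^ 2 + a / θ ^ 2 := by
      rw [← massSq_mul ha ham, ← massSq_add ha ham]; ring
    rw [div_mul_div_comm, hprod]
    have : 0 < a / θ ^ 2 := by positivity
    have h3 : a / (θ ^ 2 * ‖k‖ ^ 2) = a / θ ^ 2 / ‖k‖ ^ 2 := by rw [div_div]
    rw [h3]
    generalize a / θ ^ 2 = c at *
    generalize ‖k‖ ^ 2 = s at *
    have h4 : s * s + m ^ 2 * s + c ≠ 0 := by positivity
    have h5 : s + m ^ 2 ≠ 0 := by positivity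
    have h6 : s + m ^ 2 + c / s ≠ 0 := by positivity
    field_simp
    ring

end Masses

section Schwinger

theorem integrable_prod_exp_neg {ι : Type*} [Fintype ι] {b : ι → ℝ} (hb : ∀ i, 0 < b i) (c : ℝ) :
    Integrable (fun x : ι → ℝ => ∏ i, Real.exp (-b i * x i))
      (volume.restrict (Set.univ.pi fun _ => Set.Ioi c)) := by
  rw [volume_pi, Measure.restrict_pi_pi]
  exact Integrable.fintype_prod (f := fun i x => Real.exp (-b i * x)) fun i =>
    integrableOn_exp_mul_Ioi (neg_neg_of_pos (hb i)) c

theorem integral_prod_exp_neg {ι : Type*} [Fintype ι] {b : ι → ℝ} (hb : ∀ i, 0 < b i) (c : ℝ) :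
    ∫ x in Set.univ.pi fun _ : ι => Set.Ioi c, ∏ i, Real.exp (-b i * x i) =
      ∏ i, Real.exp (-c * b i) * (1 / b i) := by
  rw [volume_pi, Measure.restrict_pi_pi,
    integral_fintype_prod_eq_prod (fun i x => Real.exp (-b i * x))]
  refine Finset.prod_congr rfl fun i _ => ?_
  rw [integral_exp_mul_Ioi (neg_neg_of_pos (hb i))]
  rw [neg_div_neg_eq, mul_one_div]
  congr 2
  ring

variable {E : Type*} [Fintype E] [DecidableEq E]

omit [Fintype E] [DecidableEq E] in
theorem schwingerRegion_eq (ε : ℝ) (J : Finset E) : schwingerRegion ε J =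
    (Set.univ.pi fun _ => Set.Ioi ε) ×ˢ
      ((Set.univ.pi fun _ => Set.Ioi 0) ×ˢ (Set.univ.pi fun _ => Set.Ioi 0)) := by
  ext z
  simp [schwingerRegion]

omit [DecidableEq E] in
theorem measurableSet_schwingerRegion (ε : ℝ) (J : Finset E) :
    MeasurableSet (schwingerRegion ε J) := by
  rw [schwingerRegion_eq]
  exact (MeasurableSet.univ_pi fun _ => measurableSet_Ioi).prod
    ((MeasurableSet.univ_pi fun _ => measurableSet_Ioi).prod
      (MeasurableSet.univ_pi fun _ => measurableSet_Ioi))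

omit [DecidableEq E] in
theorem volume_restrict_schwingerRegion (ε : ℝ) (J : Finset E) :
    (volume : Measure (Schwinger J)).restrict (schwingerRegion ε J) =
      (volume.restrict (Set.univ.pi fun _ => Set.Ioi ε)).prod
        ((volume.restrict (Set.univ.pi fun _ => Set.Ioi 0)).prod
          (volume.restrict (Set.univ.pi fun _ => Set.Ioi 0))) := by
  rw [schwingerRegion_eq, Measure.prod_restrict, Measure.prod_restrict]
  rfl

omit [Fintype E] in
theorem shiftedParam_pos {ε : ℝ} (hε : 0 ≤ ε) {J : Finset E} {z : Schwinger J}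
    (hz : z ∈ schwingerRegion ε J) (e : E) : 0 < shiftedParam J z e := by
  obtain ⟨h1, h2, h3⟩ := hz
  rw [shiftedParam]
  split_ifs with h
  · linarith [h1 e, h2 ⟨e, h⟩, h3 ⟨e, h⟩]
  · linarith [h1 e]

theorem sum_shiftedParam_mul (J : Finset E) (z : Schwinger J) (s : E → ℝ) :
    ∑ e, shiftedParam J z e * s e =
      ∑ e, z.1 e * s e +
        (∑ e : {e // e ∈ J}, z.2.1 e * s e + ∑ e : {e // e ∈ J}, z.2.2 e * s e) := by
  have h : ∀ u : {e // e ∈ J} → ℝ, ∑ e : {e // e ∈ J}, u e * s e =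
      ∑ e, (if h : e ∈ J then u ⟨e, h⟩ else 0) * s e := by
    intro u
    rw [← Fintype.sum_subtype_add_sum_subtype (· ∈ J) fun e =>
      (if h : e ∈ J then u ⟨e, h⟩ else 0) * s e, Finset.sum_eq_zero (s := univ (α := {e // e ∉ J}))
        fun e _ => by simp [e.2], add_zero]
    trans ∑ e : {e // e ∈ J}, (if h : (e : E) ∈ J then u ⟨e, h⟩ else 0) * s e
    · exact Finset.sum_congr rfl fun e _ => by simp
    · congr!
  rw [h, h, ← Finset.sum_add_distrib, ← Finset.sum_add_distrib]
  refine Finset.sum_congr rfl fun e _ => ?_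
  rw [shiftedParam]
  split_ifs <;> ring

/-- The Schwinger integrand at fixed squares `s` of the line momenta. -/
noncomputable def schwingerIntegrand (θ m a : ℝ) (J : Finset E) (s : E → ℝ) (z : Schwinger J) : ℝ :=
  Real.exp (-∑ e, shiftedParam J z e * s e) * Real.exp (-∑ e, z.1 e * m ^ 2) *
    Real.exp (-∑ e, z.2.1 e * massSq₁ θ m a) * Real.exp (-∑ e, z.2.2 e * massSq₂ θ m a)

theorem schwingerIntegrand_eq (θ m a : ℝ) (J : Finset E) (s : E → ℝ) (z : Schwinger J) :
    schwingerIntegrand θ m a J s z = (∏ e, Real.exp (-(s e + m ^ 2) * z.1 e)) *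
      ((∏ e : {e // e ∈ J}, Real.exp (-(s e + massSq₁ θ m a) * z.2.1 e)) *
        ∏ e : {e // e ∈ J}, Real.exp (-(s e + massSq₂ θ m a) * z.2.2 e)) := by
  rw [schwingerIntegrand, sum_shiftedParam_mul]
  simp only [← Real.exp_sum, ← Real.exp_add]
  congr 1
  simp only [neg_mul, add_mul, Finset.sum_neg_distrib, Finset.sum_add_distrib, mul_comm]
  ring

/-- The result of integrating over the Schwinger parameters: cut-off commutative propagators on all
lines, and the correction factors on the lines in `J`. -/
noncomputable def lineWeight (θ m a ε : ℝ) (J : Finset E) (s : E → ℝ) : ℝ :=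
  (∏ e, Real.exp (-ε * (s e + m ^ 2)) * (1 / (s e + m ^ 2))) *
    ∏ e ∈ J, 1 / (s e + massSq₁ θ m a) * (1 / (s e + massSq₂ θ m a))

variable {θ m a : ℝ}

theorem integrable_schwingerIntegrand (ha : 0 < a) (ham : a ≤ θ ^ 2 * m ^ 4 / 4) (ε : ℝ)
    (J : Finset E) {s : E → ℝ} (hs : ∀ e, 0 ≤ s e) :
    Integrable (schwingerIntegrand θ m a J s) (volume.restrict (schwingerRegion ε J)) := by
  have h0 := (sq_pos_of_mass ha ham).2
  obtain ⟨h1, h2⟩ := massSq_pos ha ham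
  rw [volume_restrict_schwingerRegion]
  have hpos : ∀ {M : ℝ}, 0 < M → ∀ e, 0 < s e + M := fun hM e => add_pos_of_nonneg_of_pos (hs e) hM
  refine ((integrable_prod_exp_neg (hpos h0) ε).mul_prod
    ((integrable_prod_exp_neg (fun e : {e // e ∈ J} => hpos h1 e) 0).mul_prod
      (integrable_prod_exp_neg (fun e : {e // e ∈ J} => hpos h2 e) 0))).congr
    (Filter.Eventually.of_forall fun z => ?_)
  exact (schwingerIntegrand_eq θ m a J s z).symm

theorem integral_schwingerIntegrand (ha : 0 < a) (ham : a ≤ θ ^ 2 * m ^ 4 / 4) (ε : ℝ)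
    (J : Finset E) {s : E → ℝ} (hs : ∀ e, 0 ≤ s e) :
    ∫ z in schwingerRegion ε J, schwingerIntegrand θ m a J s z = lineWeight θ m a ε J s := by
  have h0 := (sq_pos_of_mass ha ham).2
  obtain ⟨h1, h2⟩ := massSq_pos ha ham
  rw [volume_restrict_schwingerRegion]
  simp_rw [schwingerIntegrand_eq]
  rw [integral_prod_mul (fun x : E → ℝ => ∏ e, Real.exp (-(s e + m ^ 2) * x e))
    (fun y : ({e // e ∈ J} → ℝ) × ({e // e ∈ J} → ℝ) =>
      (∏ e : {e // e ∈ J}, Real.exp (-(s e + massSq₁ θ m a) * y.1 e)) *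
        ∏ e : {e // e ∈ J}, Real.exp (-(s e + massSq₂ θ m a) * y.2 e)),
    integral_prod_mul
      (fun y : {e // e ∈ J} → ℝ => ∏ e : {e // e ∈ J}, Real.exp (-(s e + massSq₁ θ m a) * y e))
      (fun y : {e // e ∈ J} → ℝ => ∏ e : {e // e ∈ J}, Real.exp (-(s e + massSq₂ θ m a) * y e)),
    integral_prod_exp_neg (fun e => add_pos_of_nonneg_of_pos (hs e) h0),
    integral_prod_exp_neg fun e : {e // e ∈ J} => add_pos_of_nonneg_of_pos (hs e) h1,
    integral_prod_exp_neg fun e : {e // e ∈ J} => add_pos_of_nonneg_of_pos (hs e) h2,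
    lineWeight, ← Finset.prod_mul_distrib, ← Finset.prod_coe_sort J]
  simp

omit [DecidableEq E] in
/-- The product of the cut-off propagators, expanded over the set of lines that carry the
noncommutative correction. -/
theorem prod_ncPropagator_eq (ha : 0 < a) (ham : a ≤ θ ^ 2 * m ^ 4 / 4) (ε : ℝ) {D : ℕ}
    (k : E → EuclideanSpace ℝ (Fin D)) :
    ∏ e, Real.exp (-ε * (‖k e‖ ^ 2 + m ^ 2)) * ncPropagator θ m a (k e) =
      ∑ J : Finset E, (-(a / θ ^ 2)) ^ #J * lineWeight θ m a ε J fun e => ‖k e‖ ^ 2 := by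
  simp_rw [ncPropagator_eq ha ham, ← mul_assoc]
  rw [Finset.prod_mul_distrib, Finset.prod_one_add, Finset.powerset_univ, Finset.mul_sum]
  refine Finset.sum_congr rfl fun J _ => ?_
  simp only [mul_assoc, Finset.prod_mul_distrib (f := fun _ => -(a / θ ^ 2)), Finset.prod_const,
    lineWeight]
  ring

end Schwinger

section Amplitude

variable {V E X : Type*} [Fintype V] [Fintype E] [DecidableEq E] [Fintype X]
  {G : RibbonGraph V E X} {T : Finset E} {D : ℕ} {p : X → EuclideanSpace ℝ (Fin D)}
  {θ m a ε : ℝ}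

theorem continuous_momenta (hT : G.IsSpanningTree T) (hp : ∑ x, p x = 0) (e : E) :
    Continuous fun q => G.momenta T p q e := by
  obtain ⟨v₀⟩ := hT.1.nonempty
  obtain ⟨n, hn⟩ := exists_isFlow hT.1 v₀
  simp_rw [momenta_eq hT hn hp]
  fun_prop

theorem integrable_exp_neg_mul_sum (hT : G.IsSpanningTree T) (hp : ∑ x, p x = 0) (hε : 0 < ε) :
    Integrable fun q : {e // e ∉ T} → EuclideanSpace ℝ (Fin D) =>
      Real.exp (-∑ e, ε * ‖G.momenta T p q e‖ ^ 2) := by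
  obtain ⟨v₀⟩ := hT.1.nonempty
  -- an integral with a nonzero value converges
  by_contra h
  have h1 := integral_undef h
  rw [integral_exp_neg_sum_mul_norm_momenta_sq hT v₀ hp (β := fun _ => ε) fun _ => hε] at h1
  have h2 := symanzikU_pos hT (β := fun _ => ε) fun _ => hε
  have : 0 < Real.pi ^ ((D : ℝ) * ((Fintype.card E : ℝ) - Fintype.card V + 1) / 2) :=
    Real.rpow_pos_of_pos Real.pi_pos _
  have h3 : 0 < G.symanzikU (fun _ : E => ε) ^ ((D : ℝ) / 2) := Real.rpow_pos_of_pos h2 _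
  exact absurd h1 (by positivity)

/-- For `ε = 0` the weights are dominated by the commutative integrand, for `ε > 0` by a
Gaussian. -/
theorem integrable_lineWeight (hT : G.IsSpanningTree T) (hp : ∑ x, p x = 0) (ha : 0 < a)
    (ham : a ≤ θ ^ 2 * m ^ 4 / 4) (hε : 0 ≤ ε)
    (hconv : ε = 0 → Integrable fun q : {e // e ∉ T} → EuclideanSpace ℝ (Fin D) =>
      ∏ e, 1 / (‖G.momenta T p q e‖ ^ 2 + m ^ 2)) (J : Finset E) :
    Integrable fun q : {e // e ∉ T} → EuclideanSpace ℝ (Fin D) =>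
      lineWeight θ m a ε J fun e => ‖G.momenta T p q e‖ ^ 2 := by
  have h0 := (sq_pos_of_mass ha ham).2
  obtain ⟨h1, h2⟩ := massSq_pos ha ham
  have hcont := fun e => continuous_momenta hT hp e
  have hprop : ∀ {M : ℝ}, 0 < M → ∀ e, Continuous fun q => 1 / (‖G.momenta T p q e‖ ^ 2 + M) :=
    fun hM e => continuous_const.div (((hcont e).norm.pow 2).add continuous_const)
      fun q => by positivity
  have hexp : ∀ e, Continuous fun q => Real.exp (-ε * (‖G.momenta T p q e‖ ^ 2 + m ^ 2)) := by
    intro e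
    have := hcont e
    fun_prop
  have hle : ∀ {M : ℝ}, 0 < M → ∀ e q, 1 / (‖G.momenta T p q e‖ ^ 2 + M) ≤ 1 / M :=
    fun hM e q => one_div_le_one_div_of_le hM (by linarith [sq_nonneg ‖G.momenta T p q e‖])
  have hbase : Integrable fun q : {e // e ∉ T} → EuclideanSpace ℝ (Fin D) =>
      ∏ e, Real.exp (-ε * (‖G.momenta T p q e‖ ^ 2 + m ^ 2)) *
        (1 / (‖G.momenta T p q e‖ ^ 2 + m ^ 2)) := by
    rcases hε.eq_or_lt with h | h
    · subst h
      simpa using hconv rfl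
    · refine ((integrable_exp_neg_mul_sum hT hp h).const_mul (∏ _e : E, 1 / m ^ 2)).mono'
        (continuous_finsetProd _ fun e _ => (hexp e).mul (hprop h0 e)).aestronglyMeasurable
        (Filter.Eventually.of_forall fun q => ?_)
      rw [Real.norm_of_nonneg (Finset.prod_nonneg fun e _ => by positivity),
        ← Finset.sum_neg_distrib, Real.exp_sum, ← Finset.prod_mul_distrib]
      refine Finset.prod_le_prod (fun e _ => by positivity) fun e _ => ?_
      rw [mul_comm]
      refine mul_le_mul (hle h0 e q) (Real.exp_le_exp.2 ?_) (by positivity) (by positivity)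
      nlinarith
  refine (hbase.const_mul (∏ _e ∈ J, 1 / massSq₁ θ m a * (1 / massSq₂ θ m a))).mono'
    ((continuous_finsetProd _ fun e _ => (hexp e).mul (hprop h0 e)).mul
      (continuous_finsetProd _ fun e _ => (hprop h1 e).mul (hprop h2 e))).aestronglyMeasurable
    (Filter.Eventually.of_forall fun q => ?_)
  have hn : 0 ≤ ∏ e, Real.exp (-ε * (‖G.momenta T p q e‖ ^ 2 + m ^ 2)) *
      (1 / (‖G.momenta T p q e‖ ^ 2 + m ^ 2)) := Finset.prod_nonneg fun e _ => by positivity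
  rw [lineWeight, Real.norm_of_nonneg (mul_nonneg hn (Finset.prod_nonneg fun e _ => by positivity)),
    mul_comm]
  refine mul_le_mul_of_nonneg_right
    (Finset.prod_le_prod (fun e _ => by positivity) fun e _ => ?_) hn
  exact mul_le_mul (hle h1 e q) (hle h2 e q) (by positivity) (by positivity)

/-- Integrating the loop momenta first, at fixed Schwinger parameters. -/
theorem integral_schwingerIntegrand_momenta (hT : G.IsSpanningTree T) (v₀ : V)
    (hp : ∑ x, p x = 0) (hε : 0 ≤ ε) (J : Finset E) {z : Schwinger J}
    (hz : z ∈ schwingerRegion ε J) :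
    ∫ q : {e // e ∉ T} → EuclideanSpace ℝ (Fin D),
      schwingerIntegrand θ m a J (fun e => ‖G.momenta T p q e‖ ^ 2) z =
      Real.pi ^ ((D : ℝ) * ((Fintype.card E : ℝ) - Fintype.card V + 1) / 2) *
        G.paramIntegrand θ m a v₀ p J z := by
  simp only [schwingerIntegrand]
  rw [integral_mul_const, integral_mul_const, integral_mul_const,
    integral_exp_neg_sum_mul_norm_momenta_sq hT v₀ hp (shiftedParam_pos hε hz), paramIntegrand]
  ring

theorem integrable_schwingerIntegrand_prod (hT : G.IsSpanningTree T) (hp : ∑ x, p x = 0)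
    (ha : 0 < a) (ham : a ≤ θ ^ 2 * m ^ 4 / 4) (hε : 0 ≤ ε)
    (hconv : ε = 0 → Integrable fun q : {e // e ∉ T} → EuclideanSpace ℝ (Fin D) =>
      ∏ e, 1 / (‖G.momenta T p q e‖ ^ 2 + m ^ 2)) (J : Finset E) :
    Integrable (Function.uncurry fun (q : {e // e ∉ T} → EuclideanSpace ℝ (Fin D)) z =>
        schwingerIntegrand θ m a J (fun e => ‖G.momenta T p q e‖ ^ 2) z)
      (volume.prod (volume.restrict (schwingerRegion ε J))) := by
  have hcont := fun e => continuous_momenta hT hp e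
  have hc : Continuous (Function.uncurry
      fun (q : {e // e ∉ T} → EuclideanSpace ℝ (Fin D)) (z : Schwinger J) =>
        schwingerIntegrand θ m a J (fun e => ‖G.momenta T p q e‖ ^ 2) z) := by
    simp only [Function.uncurry_def, schwingerIntegrand_eq]
    fun_prop
  have hnorm : ∀ (q : {e // e ∉ T} → EuclideanSpace ℝ (Fin D)),
      ∫ z in schwingerRegion ε J,
        ‖schwingerIntegrand θ m a J (fun e => ‖G.momenta T p q e‖ ^ 2) z‖ =
      lineWeight θ m a ε J fun e => ‖G.momenta T p q e‖ ^ 2 := by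
    intro q
    rw [← integral_schwingerIntegrand ha ham ε J fun e => sq_nonneg ‖G.momenta T p q e‖]
    congr 1
    ext z
    exact Real.norm_of_nonneg (by rw [schwingerIntegrand]; positivity)
  rw [integrable_prod_iff hc.aestronglyMeasurable]
  constructor
  · refine Filter.Eventually.of_forall fun q => ?_
    simp only [Function.uncurry_apply_pair]
    exact integrable_schwingerIntegrand ha ham ε J (s := fun e => ‖G.momenta T p q e‖ ^ 2)
      fun e => sq_nonneg _
  · simp only [Function.uncurry_apply_pair, hnorm]
    exact integrable_lineWeight hT hp ha ham hε hconv J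

theorem integrableOn_paramIntegrand (hT : G.IsSpanningTree T) (v₀ : V) (hp : ∑ x, p x = 0)
    (ha : 0 < a) (ham : a ≤ θ ^ 2 * m ^ 4 / 4) (hε : 0 ≤ ε)
    (hconv : ε = 0 → Integrable fun q : {e // e ∉ T} → EuclideanSpace ℝ (Fin D) =>
      ∏ e, 1 / (‖G.momenta T p q e‖ ^ 2 + m ^ 2)) (J : Finset E) :
    IntegrableOn (G.paramIntegrand θ m a v₀ p J) (schwingerRegion ε J) := by
  have h := (integrable_schwingerIntegrand_prod hT hp ha ham hε hconv J).integral_prod_right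
  have hπ : Real.pi ^ ((D : ℝ) * ((Fintype.card E : ℝ) - Fintype.card V + 1) / 2) ≠ 0 :=
    (Real.rpow_pos_of_pos Real.pi_pos _).ne'
  refine (h.const_mul
    (Real.pi ^ ((D : ℝ) * ((Fintype.card E : ℝ) - Fintype.card V + 1) / 2))⁻¹).congr ?_
  filter_upwards [ae_restrict_mem (measurableSet_schwingerRegion ε J)] with z hz
  simp only [Function.uncurry_apply_pair]
  rw [integral_schwingerIntegrand_momenta hT v₀ hp hε J hz, inv_mul_cancel_left₀ hπ]

theorem integral_lineWeight (hT : G.IsSpanningTree T) (v₀ : V) (hp : ∑ x, p x = 0)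
    (ha : 0 < a) (ham : a ≤ θ ^ 2 * m ^ 4 / 4) (hε : 0 ≤ ε)
    (hconv : ε = 0 → Integrable fun q : {e // e ∉ T} → EuclideanSpace ℝ (Fin D) =>
      ∏ e, 1 / (‖G.momenta T p q e‖ ^ 2 + m ^ 2)) (J : Finset E) :
    ∫ q : {e // e ∉ T} → EuclideanSpace ℝ (Fin D),
      lineWeight θ m a ε J (fun e => ‖G.momenta T p q e‖ ^ 2) =
      Real.pi ^ ((D : ℝ) * ((Fintype.card E : ℝ) - Fintype.card V + 1) / 2) *
        ∫ z in schwingerRegion ε J, G.paramIntegrand θ m a v₀ p J z := by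
  have h1 : ∀ q : {e // e ∉ T} → EuclideanSpace ℝ (Fin D),
      lineWeight θ m a ε J (fun e => ‖G.momenta T p q e‖ ^ 2) =
      ∫ z in schwingerRegion ε J,
        schwingerIntegrand θ m a J (fun e => ‖G.momenta T p q e‖ ^ 2) z := fun q =>
    (integral_schwingerIntegrand ha ham ε J fun e => sq_nonneg _).symm
  simp_rw [h1]
  rw [integral_integral_swap (integrable_schwingerIntegrand_prod hT hp ha ham hε hconv J),
    ← integral_const_mul]
  exact setIntegral_congr_fun (measurableSet_schwingerRegion ε J) fun z hz =>
    integral_schwingerIntegrand_momenta hT v₀ hp hε J hz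

end Amplitude

end RibbonGraph

/-! ### The amplitude -/

theorem theorem4p1 {V E X : Type*} [Fintype V] [Fintype E] [DecidableEq E] [Fintype X]
    (G : RibbonGraph V E X) (hG : G.IsPlanarRegular)
    (T : Finset E) (hT : G.IsSpanningTree T)
    (D : ℕ) (hD : Even D) (θ m a : ℝ) (ha : 0 < a) (ham : a ≤ θ ^ 2 * m ^ 4 / 4)
    (p : X → EuclideanSpace ℝ (Fin D)) (hp : ∑ x, p x = 0)
    (h₀ : (E × Bool) ⊕ X) (hh₀ : ∀ x : X, G.facePerm.SameCycle h₀ (Sum.inr x))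
    (v₀ : V) (ε : ℝ) (hε : 0 ≤ ε)
    (hconv : ε = 0 → MeasureTheory.Integrable
      fun q : {e // e ∉ T} → EuclideanSpace ℝ (Fin D) =>
        ∏ e, 1 / (‖G.momenta T p q e‖ ^ 2 + m ^ 2)) :
    MeasureTheory.Integrable (G.feynmanIntegrand θ m a ε T p) ∧
    (∀ J : Finset E, MeasureTheory.IntegrableOn (G.paramIntegrand θ m a v₀ p J)
      (RibbonGraph.schwingerRegion ε J)) ∧
    G.feynmanAmplitude θ m a ε T p =
      G.externalPhase θ h₀ p *
      ((Real.pi ^ ((D : ℝ) * ((Fintype.card E : ℝ) - Fintype.card V + 1) / 2) *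
        ∑ r ∈ Finset.range (Fintype.card E + 1), (-(a / θ ^ 2)) ^ r *
          ∑ J ∈ Finset.powersetCard r (Finset.univ : Finset E),
            ∫ z in RibbonGraph.schwingerRegion ε J, G.paramIntegrand θ m a v₀ p J z : ℝ) : ℂ) := by
  classical
  have hphase : ∀ q, G.vertexPhase θ p (G.momenta T p q) = G.externalPhase θ h₀ p := fun q =>
    RibbonGraph.vertexPhase_eq_externalPhase hG.1 hT θ hp hh₀
      (RibbonGraph.momenta_spec hT hp q).1
  have hint := fun J => RibbonGraph.integrable_lineWeight hT hp ha ham hε hconv J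
  have hfun : G.feynmanIntegrand θ m a ε T p = fun q => G.externalPhase θ h₀ p *
      ((∑ J : Finset E, (-(a / θ ^ 2)) ^ J.card *
        RibbonGraph.lineWeight θ m a ε J fun e => ‖G.momenta T p q e‖ ^ 2 : ℝ) : ℂ) := by
    ext q
    rw [RibbonGraph.feynmanIntegrand, hphase, RibbonGraph.prod_ncPropagator_eq ha ham]
  refine ⟨?_, RibbonGraph.integrableOn_paramIntegrand hT v₀ hp ha ham hε hconv, ?_⟩
  · rw [hfun]
    exact (MeasureTheory.integrable_finsetSum _ fun J _ => (hint J).const_mul _).ofReal.const_mul _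
  · rw [RibbonGraph.feynmanAmplitude, hfun, MeasureTheory.integral_const_mul,
      integral_complex_ofReal,
      MeasureTheory.integral_finsetSum _ fun J _ => (hint J).const_mul _]
    congr 2
    simp_rw [MeasureTheory.integral_const_mul,
      RibbonGraph.integral_lineWeight hT v₀ hp ha ham hε hconv]
    rw [← Finset.powerset_univ, Finset.sum_powerset, Finset.card_univ, Finset.mul_sum]
    refine Finset.sum_congr rfl fun r _ => ?_
    rw [Finset.mul_sum, Finset.mul_sum]
    refine Finset.sum_congr rfl fun J hJ => ?_
    rw [(Finset.mem_powersetCard.1 hJ).2]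
    ring
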